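/- A \emph{knot projection} $P$ is a generic immersed closed curve (the image of one circle) on the sphere $S^2$ with at least one double point; it is given by the embedded $4$-valent graph on $S^2$ whose vertices are its double points, i.e. by a $4$-regular rotation system with $V-E+F=2$ whose straight-ahead traversal has one component. A double point is \emph{nugatory} if some region of the complement of the curve occurs at two opposite corners of it (equivalently, a circle crosses the curve at this double point and meets it nowhere else). $P$ is \emph{reducible} if it has a nugatory double point, and \emph{reduced} otherwise. A \emph{splice} at a double point replaces the crossing by two disjoint arcs; there are two splices, the Seifert splice, which respects an orientation of the curve, and the non-Seifert splice, which does not. Let $t(P)$ be the minimal number of splices, each of either kind, whose simultaneous application (at distinct double points) to $P$ yields a reducible knot projection (in particular a curve with a single component). A \emph{circle through} $k$ double points of $P$ is an oriented simple closed curve on $S^2$ that meets $P$ in exactly these $k$ double points, successively $v_0,\dots,v_{k-1}$ (indices mod $k$), and at each $v_i$ has two of the four branches of $P$ on each side, and that passes through $k$ distinct regions of $P$. On each side, one of the two branches at $v_i$ is the \emph{forward} one (next to the part of the circle leaving $v_i$) and the other is the \emph{backward} one. Each branch begins an arc of $P$ which ends where it next meets the circle. \textbf{Theorem.} Let $P$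 be a reduced knot projection. Then $t(P)=2$ if and only if (a) and (b) hold. (a) There is no circle through exactly two double points $v_0,v_1$ of $P$ such that on the left side the forward branch at each of $v_0,v_1$ is joined by an arc to the backward branch at the other one, while on the right side the two forward branches are joined by an arc and the two backward branches are joined by an arc. (b) There is a circle of one of the following types. (b1) A circle through exactly two double points $v_0,v_1$ such that on the left side the two branches at $v_0$ are joined by an arc and the two branches at $v_1$ are joined by an arc, and on the right side either each forward branch is joined to the backward branch at the other point, or forward is joined to forward and backward to backward. (b2) A circle through exactly three double points $v_0,v_1,v_2$ such that on each side each $v_i$ is joined to $v_{i+1}$ by exactly one arc, with the following branches. Let $l_i\in\{0,1\}$ be $0$ if the left arc from $v_i$ to $v_{i+1}$ uses the forward branch at $v_i$ (so that the left arc from $v_i$ to $v_{i-1}$ uses the backward branch), and $1$ in the opposite case; define $r_i$ in the same way on the right. Then either $l_i=r_i$ for all $i$, or $l_i\neq r_i$ for exactly one $i$. (Splicing along the circle, i.e. so that the circle can pass between the two new arcs, is in the first case of (b2) a Seifert splice at all three points; in the second case it is a Seifert splice at the point with $l_i\ne r_i$ and a non-Seifert splice at the other two, which contains the mixed Seifert/non-Seifert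 configurations.) -/

import Mathlib

/-- A knot projection: a generic immersed closed curve on the oriented sphere with at least one
double point, given by its underlying 4-valent map on the sphere (a rotation system).
`D` is the set of darts: a dart is an edge together with one of its two ends, and is thought of as
leaving the double point at that end. `rot` turns a dart counterclockwise to the next dart at the
same double point and `opp` passes to the other end of the edge. So the double points are the
cycles of `rot`, the edges are the cycles of `opp`, and the faces are the cycles of
`rot⁻¹ * opp`. Going straight ahead at a double point is turning by `rot` twice. -/
structure KnotProjection (D : Type*) where
  rot : Equiv.Perm D
  opp : Equiv.Perm D
  finite : Finite D
  nonempty : Nonempty D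
  /-- Every double point has exactly four darts. -/
  rot_four : ∀ d, rot (rot (rot (rot d))) = d
  rot_two_ne : ∀ d, rot (rot d) ≠ d
  opp_opp : ∀ d, opp (opp d) = d
  opp_ne : ∀ d, opp d ≠ d
  /-- The curve is the image of one circle. -/
  one_component : ∀ d e, Relation.EqvGen (fun x y => y = opp x ∨ y = rot (rot x)) d e
  /-- The surface is the sphere: `V + F = E + 2`. -/
  euler :
    Nat.card (Quotient (Equiv.Perm.SameCycle.setoid rot)) +
      Nat.card (Quotient (Equiv.Perm.SameCycle.setoid (rot⁻¹ * opp))) =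
    Nat.card (Quotient (Equiv.Perm.SameCycle.setoid opp)) + 2

/-- The two kinds of splices of a double point. -/
inductive SpliceKind where
  | seifert
  | nonSeifert

namespace KnotProjection

variable {D : Type*} (P : KnotProjection D)

/-- The double points. -/
def DoublePoint : Type _ := Quotient (Equiv.Perm.SameCycle.setoid P.rot)

/-- The double point which the dart `d` leaves. -/
def vertex (d : D) : P.DoublePoint := Quotient.mk (Equiv.Perm.SameCycle.setoid P.rot) d

/-- Traverse the edge of `d` and go straight ahead at the double point at its other end. -/
def ahead : Equiv.Perm D := P.rot * P.rot * P.opp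

/-- Some traversal of the whole curve runs along both darts `d` and `e` (away from
their double points). -/
def Cooriented (d e : D) : Prop := P.ahead.SameCycle d e

/-- A choice of splices, to be applied simultaneously: `none` leaves the double point alone. -/
abbrev Splicing : Type _ := P.DoublePoint → Option SpliceKind

/-- No splice at all. -/
def noSplice : P.Splicing := fun _ => none

/-- The *corner* `d` is the sector at a double point from the dart `d` counterclockwise to the dart
`rot d`. A splice replaces the crossing by two disjoint arcs, which leaves a channel joining two
opposite corners. `Open s d` says that the splice at the double point of `d` opens such a channel
from the corner `d` to the opposite corner `rot (rot d)`; the two new arcs then join `d` to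
`rot⁻¹ d` and `rot d` to `rot (rot d)`. These arcs respect the orientation of the curve
exactly if `d` and `rot d` are both outgoing or both incoming. -/
def Open (s : P.Splicing) (d : D) : Prop :=
  (s (P.vertex d) = some SpliceKind.seifert ∧ P.Cooriented d (P.rot d)) ∨
  (s (P.vertex d) = some SpliceKind.nonSeifert ∧ ¬ P.Cooriented d (P.rot d))

open Classical in
/-- The dart at the same double point to which `d` is connected by the spliced curve. -/
noncomputable def through (s : P.Splicing) (d : D) : D :=
  if s (P.vertex d) = none then P.rot (P.rot d)
  else if P.Open s d then P.rot⁻¹ d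
  else P.rot d

/-- `d` and `e` lie on the same component of the spliced curve. -/
def SameComponent (s : P.Splicing) : D → D → Prop :=
  Relation.EqvGen fun x y => y = P.opp x ∨ y = P.through s x

/-- The corners `d` and `e` lie in the same connected component of the complement of the spliced
curve in the sphere: the faces of `P` are joined to each other by the channels. -/
def SameRegion (s : P.Splicing) : D → D → Prop :=
  Relation.EqvGen fun x y => y = (P.rot⁻¹ * P.opp) x ∨ (P.Open s x ∧ y = P.rot (P.rot x))

/-- The spliced curve is a reducible knot projection: it has a single component, and it has a
nugatory crossing, that is, a double point with a region at two opposite corners (a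
circle in this region through the double point meets the spliced curve nowhere else). -/
def IsReducibleAfter (s : P.Splicing) : Prop :=
  (∀ d e, P.SameComponent s d e) ∧
  ∃ d, s (P.vertex d) = none ∧ P.SameRegion s d (P.rot (P.rot d))

/-- `P` has no nugatory crossing. -/
def IsReduced : Prop := ¬ P.IsReducibleAfter P.noSplice

/-- `t(P)`: the least number of splices, of either kind and applied simultaneously, which turn `P`
into a reducible knot projection (`⊤` if there were none). -/
noncomputable def t : ℕ∞ :=
  ⨅ (s : P.Splicing) (_ : P.IsReducibleAfter s), Set.encard {v | s v ≠ none}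

/-- `c` describes an oriented simple closed curve which meets `P` in exactly `k` double points, the
double points of `c 0, …, c (k - 1)` in this order, and separates two darts from two darts at each of
them. The curve leaves the double point of `c i` through the corner `c i` and enters it through the
opposite corner. To the left of the curve are the darts `rot (c i)` (pointing forward) and
`rot (rot (c i))` (backward), to the right are `c i` (forward) and `rot⁻¹ (c i)` (backward). -/
structure IsCircle {k : ℕ} [NeZero k] (c : Fin k → D) : Prop where
  vertex_injective : Function.Injective fun i => P.vertex (c i)
  region_next : ∀ i, P.SameRegion P.noSplice (c i) (P.rot (P.rot (c (i + 1))))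
  region_ne : ∀ i j, i ≠ j → ¬ P.SameRegion P.noSplice (c i) (c j)

/-- The arc of `P` that starts along the dart `d` ends, when it meets the double points
of `c` for the first time again, at the dart `e`. -/
def ArcJoins {k : ℕ} (c : Fin k → D) (d e : D) : Prop :=
  ∃ n : ℕ, e = P.opp ((P.ahead ^ n) d) ∧ (∃ i, P.vertex e = P.vertex (c i)) ∧
    ∀ m < n, ∀ i, P.vertex (P.opp ((P.ahead ^ m) d)) ≠ P.vertex (c i)

/-- Left dart at the `i`-th point: forward if `b = false`, backward if `b = true`. -/
def leftDart {k : ℕ} (c : Fin k → D) (i : Fin k) (b : Bool) : D :=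
  if b then P.rot (P.rot (c i)) else P.rot (c i)

/-- Right dart at the `i`-th point: forward if `b = false`, backward if `b = true`. -/
def rightDart {k : ℕ} (c : Fin k → D) (i : Fin k) (b : Bool) : D :=
  if b then P.rot⁻¹ (c i) else c i

/-- A circle through exactly two double points such that on both sides the arcs of `P` run from one
of them to the other, uncrossed (forward to backward, backward to forward) on the left and
crossed (forward to forward, backward to backward) on the right. -/
def HasInterlacedTwoCircle : Prop :=
  ∃ c : Fin 2 → D, P.IsCircle c ∧
    (∀ b, P.ArcJoins c (P.leftDart c 0 b) (P.leftDart c 1 (!b))) ∧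
    (∀ b, P.ArcJoins c (P.rightDart c 0 b) (P.rightDart c 1 b))

/-- A circle through exactly two double points such that on the left each of
them is joined to itself by an arc of `P`, and on the right the two arcs of `P` run from one to the
other, uncrossed or crossed. -/
def HasParallelTwoCircle : Prop :=
  ∃ c : Fin 2 → D, P.IsCircle c ∧
    (∀ i, P.ArcJoins c (P.leftDart c i false) (P.leftDart c i true)) ∧
    ((∀ b, P.ArcJoins c (P.rightDart c 0 b) (P.rightDart c 1 (!b))) ∨
      (∀ b, P.ArcJoins c (P.rightDart c 0 b) (P.rightDart c 1 b)))

/-- A circle through exactly three double points such that on each side any two of them are joined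
by exactly one arc of `P`. The pictures are described by `l i` and `r i`: on the left (right), the
arc from the `i`-th point to the next one leaves along the forward dart if `l i = false`
(`r i = false`) and along the backward dart otherwise, and the arc to the previous point
leaves along the other one. The pictures that occur are:
* `l = r` (up to symmetry four of them; all three crossings are spliced along the circle by Seifert
  splices);
* `l` and `r` differ at a single point (up to symmetry and mirror images three of them; the
  splice along the circle is Seifert at that point and non-Seifert at the other two, so
  that two splices are both non-Seifert or of mixed type). -/
def HasThreeCircle : Prop :=
  ∃ c : Fin 3 → D, P.IsCircle c ∧ ∃ l r : Fin 3 → Bool,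
    (∀ i, P.ArcJoins c (P.leftDart c i (l i)) (P.leftDart c (i + 1) (!(l (i + 1))))) ∧
    (∀ i, P.ArcJoins c (P.rightDart c i (r i)) (P.rightDart c (i + 1) (!(r (i + 1))))) ∧
    (l = r ∨ ∃! i, l i ≠ r i)

end KnotProjection

/-! Suppose that a splicing creates a nugatory crossing `d`. A path through regions and channels
from the corner `d` to the opposite corner, shortened as far as possible, is a circle through `d`
and spliced double points that are all spliced along it; with at most two splices it has two or
three points (`exists_isCircle`). Conversely, splicing along such a circle at all its points but one
makes the remaining one nugatory. What is left to decide is whether the spliced curve is connected,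
and this is read off from the way the arcs of `P` match the branches on each side. Arcs stay on
their side by a discrete Jordan curve theorem (`IsCircle.exists_side`), which follows from Euler's
formula by a dimension count (`exists_potential`).

Two points: two equal pictures on the two sides would close up to a component that misses some
branches, so the circle is interlaced or parallel. An interlaced one needs a single splice. For a
parallel one, an arc from a point to itself is cut off by the splice there, so one splice is not
enough. But `P` is reduced, so this loop crosses the rest of the curve away from the circle, and a
second splice at such a crossing merges the two components (`sameComponent_of_merging`).

Three points: connectedness forbids arcs from a point to itself, so each side shows a cyclic
matching, and the two matchings differ at one point at most (`IsCircle.hasThreeCircle`). Conversely,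
after two splices a cyclic matching makes each side one strand, and the unspliced crossing joins
both strands. -/

namespace KnotProjection

/-! ### Darts, orientations of the curve, and splices as fixed-point-free involutions. -/

section Basic

variable {D : Type*}

theorem mem_iff_of_sameCycle {σ : Equiv.Perm D} {p : D → Prop} (hp : ∀ x, p (σ x) ↔ p x)
    {x y : D} (h : σ.SameCycle x y) : p x ↔ p y := by
  have key : ∀ (n : ℕ) (z : D), p ((σ ^ n) z) ↔ p z := by
    intro n
    induction n with
    | zero => simp
    | succ n ih => intro z; rw [pow_succ, Equiv.Perm.mul_apply, ih, hp]
  obtain ⟨n, rfl⟩ := h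
  obtain ⟨m, rfl | rfl⟩ := n.eq_nat_or_neg
  · rw [zpow_natCast, key]
  · rw [← key m ((σ ^ (-(m : ℤ))) x), zpow_neg, zpow_natCast, ← Equiv.Perm.mul_apply,
      mul_inv_cancel, Equiv.Perm.one_apply]

theorem even_card_of_involution {D : Type*} {S : Finset D} {σ : D → D}
    (hσ : ∀ x, σ (σ x) = x) (hne : ∀ x, σ x ≠ x) (hS : ∀ x ∈ S, σ x ∈ S) : Even S.card := by
  have h : ∑ _x ∈ S, (1 : ZMod 2) = 0 :=
    Finset.sum_involution (fun x _ => σ x) (fun _ _ => by decide) (fun x _ _ => hne x)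
      (fun x hx => hS x hx) (fun x _ => hσ x)
  rw [Finset.sum_const, nsmul_one] at h
  exact (ZMod.natCast_eq_zero_iff_even).1 h

/-- A set that is closed under one fixed-point-free involution, and under another one except
possibly at `a`, is closed under the latter at `a`, too. -/
theorem apply_mem_of_involutions [Finite D] {S : Set D} {σ τ : D → D}
    (hσ : ∀ x, σ (σ x) = x) (hσne : ∀ x, σ x ≠ x) (hτ : ∀ x, τ (τ x) = x) (hτne : ∀ x, τ x ≠ x)
    {a : D} (ha : a ∈ S) (hSσ : ∀ x ∈ S, σ x ∈ S) (hSτ : ∀ x ∈ S, x ≠ a → τ x ∈ S) :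
    τ a ∈ S := by
  classical
  by_contra h
  have := Fintype.ofFinite D
  have h1 : Even S.toFinset.card := even_card_of_involution hσ hσne (by simpa using hSσ)
  -- If `τ a` were outside `S`, then `τ` would pair off `S` without `a` while `σ` pairs off `S`:
  -- both cardinalities would be even.
  have h2 : Even (S.toFinset.erase a).card := by
    refine even_card_of_involution hτ hτne fun x hx => ?_
    simp only [Finset.mem_erase, Set.mem_toFinset] at hx ⊢
    refine ⟨?_, hSτ x hx.2 hx.1⟩
    rintro rfl
    rw [hτ] at h
    exact h hx.2
  rw [← Finset.card_erase_add_one (a := a) (by simpa using ha)] at h1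
  exact (Nat.even_add_one.1 h1) h2

variable (P : KnotProjection D)

theorem rot_inv_apply (x : D) : P.rot⁻¹ x = P.rot (P.rot (P.rot x)) := by
  rw [Equiv.Perm.inv_eq_iff_eq, P.rot_four]

theorem rot_ne (x : D) : P.rot x ≠ x := fun h => P.rot_two_ne x (by rw [h, h])

theorem rot_three_ne (x : D) : P.rot (P.rot (P.rot x)) ≠ x := fun h =>
  P.rot_ne x (by conv_lhs => rw [← h, P.rot_four])

theorem vertex_eq_iff_sameCycle (x y : D) : P.vertex x = P.vertex y ↔ P.rot.SameCycle x y :=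
  Quotient.eq (r := Equiv.Perm.SameCycle.setoid P.rot)

@[simp] theorem vertex_rot (x : D) : P.vertex (P.rot x) = P.vertex x := by
  rw [eq_comm, vertex_eq_iff_sameCycle]
  exact ⟨1, by simp⟩

@[simp] theorem vertex_rot_symm (x : D) : P.vertex (P.rot.symm x) = P.vertex x := by
  rw [← P.vertex_rot, Equiv.apply_symm_apply]

theorem eq_of_vertex_eq {x y : D} (h : P.vertex y = P.vertex x) :
    y = x ∨ y = P.rot x ∨ y = P.rot (P.rot x) ∨ y = P.rot (P.rot (P.rot x)) := by
  rw [eq_comm, vertex_eq_iff_sameCycle] at h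
  refine (mem_iff_of_sameCycle
    (p := fun y => y = x ∨ y = P.rot x ∨ y = P.rot (P.rot x) ∨ y = P.rot (P.rot (P.rot x)))
    (fun z => ?_) h).1 (Or.inl rfl)
  have := P.rot_four x
  constructor
  · rintro (h | h | h | h)
    · right; right; right
      apply P.rot.injective; rw [h, this]
    all_goals simp only [EmbeddingLike.apply_eq_iff_eq] at h; simp [h]
  · rintro (h | h | h | h) <;> simp [h, this]

/-- A set of darts that is a union of components of the curve is trivial. -/
theorem mem_of_closed {S : Set D} (h1 : ∀ x ∈ S, P.opp x ∈ S)
    (h2 : ∀ x ∈ S, P.rot (P.rot x) ∈ S) {x : D} (hx : x ∈ S) (y : D) : y ∈ S := by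
  have key : ∀ a b, Relation.EqvGen (fun x y => y = P.opp x ∨ y = P.rot (P.rot x)) a b →
      (a ∈ S ↔ b ∈ S) := by
    intro a b h
    induction h with
    | rel a b h =>
      rcases h with rfl | rfl
      · exact ⟨h1 a, fun h => by simpa [P.opp_opp] using h1 _ h⟩
      · exact ⟨h2 a, fun h => by simpa [P.rot_four] using h2 _ h⟩
    | refl => rfl
    | symm _ _ _ ih => exact ih.symm
    | trans _ _ _ _ _ ih1 ih2 => exact ih1.trans ih2
  exact (key x y (P.one_component x y)).1 hx

theorem ahead_apply (x : D) : P.ahead x = P.rot (P.rot (P.opp x)) := rfl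

/-- `opp` reverses the direction of travel, so it conjugates `ahead` to its inverse. -/
theorem opp_ahead_zpow (n : ℤ) (x : D) :
    P.opp ((P.ahead ^ n) x) = (P.ahead ^ (-n)) (P.opp x) := by
  have h1 : ∀ x, P.opp (P.ahead x) = P.ahead⁻¹ (P.opp x) := by
    intro x
    rw [Equiv.Perm.eq_inv_iff_eq, ahead_apply, P.opp_opp, ahead_apply, P.rot_four]
  have h2 : ∀ (n : ℕ) (x : D), P.opp ((P.ahead ^ n) x) = (P.ahead⁻¹ ^ n) (P.opp x) := by
    intro n
    induction n with
    | zero => simp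
    | succ n ih =>
      intro x
      rw [pow_succ', Equiv.Perm.mul_apply, h1, ih, pow_succ', Equiv.Perm.mul_apply]
  obtain ⟨m, rfl | rfl⟩ := n.eq_nat_or_neg
  · rw [zpow_natCast, h2, zpow_neg, zpow_natCast, inv_pow]
  · rw [neg_neg, zpow_natCast, zpow_neg, zpow_natCast]
    have := h2 m ((P.ahead ^ m)⁻¹ x)
    rw [← Equiv.Perm.mul_apply (P.ahead ^ m), mul_inv_cancel, Equiv.Perm.one_apply, inv_pow,
      Equiv.Perm.eq_inv_iff_eq] at this
    exact this.symm

/-- A traversal from `x` to its own reverse would have a middle, fixed by `opp` if the number of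
steps is even and by `rot * rot` if it is odd. -/
theorem not_cooriented_opp (x : D) : ¬ P.Cooriented x (P.opp x) := by
  rintro ⟨n, hn⟩
  obtain ⟨m, rfl | rfl⟩ := Int.even_or_odd' n
  · apply P.opp_ne ((P.ahead ^ m) x)
    rw [opp_ahead_zpow, ← hn, ← Equiv.Perm.mul_apply, ← zpow_add]
    congr 2; ring
  · apply P.rot_two_ne (P.opp ((P.ahead ^ m) x))
    rw [← ahead_apply, opp_ahead_zpow, ← hn, ← Equiv.Perm.mul_apply, ← Equiv.Perm.mul_apply,
      ← zpow_add, ← zpow_one_add]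
    congr 2; ring

theorem cooriented_opp_rot_two (x : D) : P.Cooriented (P.opp x) (P.rot (P.rot x)) :=
  ⟨1, by simp [ahead_apply, P.opp_opp]⟩

theorem cooriented_opp_opp {x y : D} (h : P.Cooriented x y) :
    P.Cooriented (P.opp x) (P.opp y) := by
  obtain ⟨n, rfl⟩ := h
  exact ⟨-n, by rw [opp_ahead_zpow]⟩

/-- With `not_cooriented_opp`, this says that a one-component curve has exactly two orientations:
`ahead` has two cycles, exchanged by `opp`. -/
theorem cooriented_or (x y : D) : P.Cooriented x y ∨ P.Cooriented (P.opp x) y := by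
  refine P.mem_of_closed (S := {y | P.Cooriented x y ∨ P.Cooriented (P.opp x) y})
    ?_ ?_ (x := x) (Or.inl (Equiv.Perm.SameCycle.refl _ _)) y
  all_goals rintro z (h | h)
  · exact Or.inr (P.cooriented_opp_opp h)
  · left; simpa [P.opp_opp] using P.cooriented_opp_opp h
  · exact Or.inr ((P.cooriented_opp_opp h).trans (P.cooriented_opp_rot_two z))
  · left
    have := (P.cooriented_opp_opp h).trans (P.cooriented_opp_rot_two z)
    rwa [P.opp_opp] at this

theorem cooriented_rot_two_right (x y : D) :
    P.Cooriented x (P.rot (P.rot y)) ↔ ¬ P.Cooriented x y := by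
  constructor
  · intro h h'
    exact P.not_cooriented_opp y (h'.symm.trans (h.trans (P.cooriented_opp_rot_two y).symm))
  · intro h
    have h1 := (P.cooriented_or x y).resolve_left h
    have := (P.cooriented_opp_opp h1).trans (P.cooriented_opp_rot_two y)
    rwa [P.opp_opp] at this

theorem cooriented_comm {x y : D} : P.Cooriented x y ↔ P.Cooriented y x :=
  ⟨Equiv.Perm.SameCycle.symm, Equiv.Perm.SameCycle.symm⟩

variable (s : P.Splicing)

/-- Opposite darts are never cooriented, so coorientation of neighbouring darts alternates around a
double point. -/
theorem open_rot (x : D) (hx : s (P.vertex x) ≠ none) : P.Open s (P.rot x) ↔ ¬ P.Open s x := by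
  unfold Open
  rw [cooriented_rot_two_right, vertex_rot, P.cooriented_comm (x := P.rot x)]
  match h : s (P.vertex x) with
  | none => exact absurd h hx
  | some .seifert => simp
  | some .nonSeifert => simp

theorem Open.ne_none {s : P.Splicing} {x : D} (h : P.Open s x) : s (P.vertex x) ≠ none := by
  rcases h with h | h <;> simp [h.1]

theorem open_rot_two (x : D) : P.Open s (P.rot (P.rot x)) ↔ P.Open s x := by
  by_cases h : s (P.vertex x) = none
  · constructor <;> intro h'
    · exact absurd h (by simpa using Open.ne_none P h')
    · exact absurd h (by simpa using Open.ne_none P h')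
  · rw [open_rot _ _ _ (by simpa using h), open_rot _ _ _ h, not_not]

theorem not_open_noSplice (x : D) : ¬ P.Open P.noSplice x := fun h => Open.ne_none P h rfl

variable {s}

theorem through_of_none {x : D} (h : s (P.vertex x) = none) : P.through s x = P.rot (P.rot x) := by
  simp [through, h]

theorem through_of_open {x : D} (h : P.Open s x) : P.through s x = P.rot⁻¹ x := by
  simp [through, h, Open.ne_none P h]

theorem through_of_open_rot {x : D} (h : P.Open s (P.rot x)) : P.through s x = P.rot x := by
  have h0 : s (P.vertex x) ≠ none := by simpa using Open.ne_none P h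
  rw [open_rot _ _ _ h0] at h
  simp [through, h, h0]

variable (s)

theorem open_or_open_rot {x : D} (h : s (P.vertex x) ≠ none) :
    P.Open s x ∨ P.Open s (P.rot x) := by
  rw [open_rot _ _ _ h]; exact em _

theorem vertex_through (x : D) : P.vertex (P.through s x) = P.vertex x := by
  unfold through; split_ifs <;> simp

theorem through_through (x : D) : P.through s (P.through s x) = x := by
  by_cases h : s (P.vertex x) = none
  · rw [P.through_of_none (x := P.through s x) (by rwa [vertex_through]), P.through_of_none h,
      P.rot_four]
  · rcases P.open_or_open_rot s h with h | h
    · rw [P.through_of_open h, P.through_of_open_rot] <;> simp [h]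
    · rw [P.through_of_open_rot h, P.through_of_open h]; simp

theorem through_ne (x : D) : P.through s x ≠ x := by
  unfold through
  split_ifs
  · exact P.rot_two_ne x
  · rw [rot_inv_apply]; exact P.rot_three_ne x
  · exact P.rot_ne x

/-- The form in which connectedness is used throughout: to refute it, exhibit a proper nonempty
invariant set of darts; to prove it, propagate membership. -/
theorem sameComponent_iff : (∀ d e, P.SameComponent s d e) ↔
    ∀ S : Set D, (∀ x ∈ S, P.opp x ∈ S) → (∀ x ∈ S, P.through s x ∈ S) →
      ∀ x ∈ S, ∀ y, y ∈ S := by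
  constructor
  · intro h S h1 h2 x hx y
    have key : ∀ a b, P.SameComponent s a b → (a ∈ S ↔ b ∈ S) := by
      intro a b h
      induction h with
      | rel a b h =>
        rcases h with rfl | rfl
        · exact ⟨h1 a, fun h => by simpa [P.opp_opp] using h1 _ h⟩
        · exact ⟨h2 a, fun h => by simpa [through_through] using h2 _ h⟩
      | refl => rfl
      | symm _ _ _ ih => exact ih.symm
      | trans _ _ _ _ _ ih1 ih2 => exact ih1.trans ih2
    exact (key x y (h x y)).1 hx
  · intro h d e
    refine h {y | P.SameComponent s d y} (fun x hx => ?_) (fun x hx => ?_) d (.refl d) e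
    · exact hx.trans _ _ _ (.rel _ _ (Or.inl rfl))
    · exact hx.trans _ _ _ (.rel _ _ (Or.inr rfl))

/-- The splice of a double point that opens the channel from the corner `w` to the opposite one. -/
noncomputable def channelKind (w : D) : SpliceKind :=
  open Classical in if P.Cooriented w (P.rot w) then .seifert else .nonSeifert

theorem open_of_eq_channelKind {w : D} (h : s (P.vertex w) = some (P.channelKind w)) :
    P.Open s w := by
  unfold Open
  rw [h]
  unfold channelKind
  split_ifs with h1 <;> simp [h1]

end Basic
end KnotProjection

/-! ### Vanishing of the first cohomology of the sphere. -/

namespace KnotProjection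

section Homology

open Module

variable {D : Type*}

/-- The functions that are constant on the cycles of `σ`. -/
def invariantFunctions (σ : Equiv.Perm D) : Submodule ℝ (EuclideanSpace ℝ D) where
  carrier := {f | ∀ x, f (σ x) = f x}
  add_mem' := fun {f g} hf hg x => by simp [hf x, hg x]
  zero_mem' := by simp
  smul_mem' := fun r f hf x => by simp [hf x]

theorem finrank_invariantFunctions [Fintype D] (σ : Equiv.Perm D) :
    finrank ℝ (invariantFunctions σ) =
      Nat.card (Quotient (Equiv.Perm.SameCycle.setoid σ)) := by
  have : Fintype (Quotient (Equiv.Perm.SameCycle.setoid σ)) := Fintype.ofFinite _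
  let g : (Quotient (Equiv.Perm.SameCycle.setoid σ) → ℝ) →ₗ[ℝ] EuclideanSpace ℝ D :=
    (WithLp.linearEquiv 2 ℝ (D → ℝ)).symm.toLinearMap ∘ₗ
      LinearMap.funLeft ℝ ℝ (Quotient.mk (Equiv.Perm.SameCycle.setoid σ))
  have hg : Function.Injective g := by
    refine (WithLp.linearEquiv 2 ℝ (D → ℝ)).symm.injective.comp ?_
    exact LinearMap.funLeft_injective_of_surjective _ _ _ Quotient.mk_surjective
  have hr : LinearMap.range g = invariantFunctions σ := by
    ext f
    constructor
    · rintro ⟨a, rfl⟩ x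
      change a (Quotient.mk _ (σ x)) = a (Quotient.mk _ x)
      congr 1
      exact Quotient.sound (s := Equiv.Perm.SameCycle.setoid σ)
        (Equiv.Perm.sameCycle_apply_left.2 (.refl _ _))
    · intro hf
      refine ⟨fun q => Quotient.lift (s := Equiv.Perm.SameCycle.setoid σ) (fun x => f x)
        (fun a b hab => ?_) q, ?_⟩
      · exact (mem_iff_of_sameCycle (p := fun z => f a = f z) (fun z => by rw [hf z]) hab).1 rfl
      · ext x; rfl
  rw [← hr, LinearMap.finrank_range_of_inj hg, finrank_fintype_fun_eq_card,
    Nat.card_eq_fintype_card]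

theorem two_mul_card_quotient [Fintype D] {σ : Equiv.Perm D} (h2 : ∀ x, σ (σ x) = x)
    (hne : ∀ x, σ x ≠ x) :
    Fintype.card D = 2 * Nat.card (Quotient (Equiv.Perm.SameCycle.setoid σ)) := by
  classical
  have : Fintype (Quotient (Equiv.Perm.SameCycle.setoid σ)) := Fintype.ofFinite _
  rw [Nat.card_eq_fintype_card, ← Finset.card_univ, ← Finset.card_univ,
    Finset.card_eq_sum_card_fiberwise (f := Quotient.mk (Equiv.Perm.SameCycle.setoid σ))
      (t := Finset.univ) (fun _ _ => Finset.mem_univ _),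
    Finset.sum_const_nat (m := 2), mul_comm]
  intro q _
  induction q using Quotient.inductionOn with
  | h a =>
    have : Finset.univ.filter (fun x => Quotient.mk (Equiv.Perm.SameCycle.setoid σ) x =
        Quotient.mk (Equiv.Perm.SameCycle.setoid σ) a) = {a, σ a} := by
      ext x
      simp only [Finset.mem_filter, Finset.mem_univ, true_and, Finset.mem_insert,
        Finset.mem_singleton, Quotient.eq]
      constructor
      · intro h
        refine (mem_iff_of_sameCycle (p := fun x => x = a ∨ x = σ a) (fun z => ?_)
          (Equiv.Perm.SameCycle.symm h)).1 (Or.inl rfl)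
        rw [or_comm, σ.injective.eq_iff]
        refine or_congr_right ⟨fun h => ?_, fun h => ?_⟩
        · rw [← h, h2]
        · rw [h, h2]
      · rintro (rfl | rfl)
        · exact .refl _ _
        · exact Equiv.Perm.sameCycle_apply_left.2 (.refl _ _)
    rw [this, Finset.card_pair (hne a).symm]

variable (P : KnotProjection D)

/-- The summation of a difference along the faces. -/
theorem sum_face_eq_zero [Fintype D] {h F : D → ℝ} (hh : ∀ x, h ((P.rot⁻¹ * P.opp) x) = h x)
    (hF : ∀ x, F (P.opp x) = F x) : ∑ x, h x * (F (P.rot x) - F x) = 0 := by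
  simp_rw [mul_sub]
  rw [Finset.sum_sub_distrib, sub_eq_zero, ← Equiv.sum_comp (P.rot⁻¹ * P.opp)]
  refine Finset.sum_congr rfl fun x _ => ?_
  rw [hh, Equiv.Perm.mul_apply, ← Equiv.Perm.mul_apply P.rot, mul_inv_cancel,
    Equiv.Perm.one_apply, hF]

theorem sum_vertex_eq_zero [Fintype D] {h F : D → ℝ} (hh : ∀ x, h (P.rot x) = h x) :
    ∑ x, h x * (F (P.rot x) - F x) = 0 := by
  simp_rw [mul_sub]
  rw [Finset.sum_sub_distrib, sub_eq_zero, ← Equiv.sum_comp P.rot (fun x => h x * F x)]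
  simp_rw [hh]

/-- A function on the sphere's darts that is invariant under `rot` and `opp` is constant. -/
theorem eq_of_invariant {f : D → ℝ} (h1 : ∀ x, f (P.rot x) = f x) (h2 : ∀ x, f (P.opp x) = f x)
    (x y : D) : f y = f x :=
  P.mem_of_closed (S := {y | f y = f x}) (fun z hz => (h2 z).trans hz)
    (fun z hz => ((h1 _).trans (h1 z)).trans hz) rfl y

/-- The coboundary of the functions on the edges. -/
noncomputable def coboundary :
    invariantFunctions P.opp →ₗ[ℝ] EuclideanSpace ℝ D where
  toFun f := WithLp.toLp 2 fun x => f.1 (P.rot x) - f.1 x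
  map_add' f g := by ext x; simp; ring
  map_smul' r f := by ext x; simp; ring

theorem finrank_le_one_of_constant [Fintype D] {V : Submodule ℝ (EuclideanSpace ℝ D)}
    (h : ∀ f ∈ V, ∀ x y, f y = f x) : finrank ℝ V ≤ 1 := by
  by_cases hD : Nonempty D
  · obtain ⟨x⟩ := hD
    have : Function.Injective
        ((LinearMap.proj (R := ℝ) (φ := fun _ : D => ℝ) x ∘ₗ
          (WithLp.linearEquiv 2 ℝ (D → ℝ)).toLinearMap) ∘ₗ V.subtype) := by
      rw [injective_iff_map_eq_zero]
      rintro ⟨f, hf⟩ h0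
      change f x = 0 at h0
      ext y
      simp [h f hf x y, h0]
    simpa using LinearMap.finrank_le_finrank_of_injective this
  · rw [not_nonempty_iff] at hD
    have : Subsingleton V := ⟨fun a b => by ext x; exact hD.elim x⟩
    simp [finrank_zero_of_subsingleton]

/-- The first cohomology of the sphere vanishes: a function on the corners whose sums around all
vertices and around all faces are zero is a coboundary. -/
theorem exists_potential [Fintype D] (χ : D → ℝ)
    (h1 : ∀ a : D → ℝ, (∀ x, a (P.rot x) = a x) → ∑ x, a x * χ x = 0)
    (h2 : ∀ a : D → ℝ, (∀ x, a ((P.rot⁻¹ * P.opp) x) = a x) → ∑ x, a x * χ x = 0) :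
    ∃ F : D → ℝ, (∀ x, F (P.opp x) = F x) ∧ ∀ x, F (P.rot x) - F x = χ x := by
  set A := invariantFunctions P.rot with hA
  set B := invariantFunctions (P.rot⁻¹ * P.opp) with hB
  set R := LinearMap.range P.coboundary with hR
  -- This is the cell complex of the medial graph: its vertices are the edges of `P`, its edges the
  -- corners, and its 2-cells the double points and the faces. Coboundaries have zero sum around
  -- every 2-cell.
  have hRle : R ≤ (A ⊔ B)ᗮ := by
    rintro _ ⟨f, rfl⟩
    rw [← Submodule.inf_orthogonal, Submodule.mem_inf, Submodule.mem_orthogonal,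
      Submodule.mem_orthogonal]
    constructor
    · intro u hu
      rw [PiLp.inner_apply]
      refine Eq.trans (Finset.sum_congr rfl fun x _ => ?_)
        (P.sum_vertex_eq_zero (h := u) (F := f.1) hu)
      simp [coboundary, mul_comm]
    · intro u hu
      rw [PiLp.inner_apply]
      refine Eq.trans (Finset.sum_congr rfl fun x _ => ?_)
        (P.sum_face_eq_zero (h := u) (F := f.1) hu f.2)
      simp [coboundary, mul_comm]
  have hdimR := P.coboundary.finrank_range_add_finrank_ker
  have hker : finrank ℝ (LinearMap.ker P.coboundary) ≤ 1 := by
    rw [← LinearMap.finrank_range_of_inj (f := (invariantFunctions P.opp).subtype ∘ₗ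
        (LinearMap.ker P.coboundary).subtype)
      ((Submodule.injective_subtype _).comp (Submodule.injective_subtype _))]
    refine finrank_le_one_of_constant ?_
    rintro _ ⟨⟨f, hf⟩, rfl⟩ x y
    refine P.eq_of_invariant (fun x => ?_) f.2 x y
    have : (P.coboundary f) x = 0 := by rw [LinearMap.mem_ker.1 hf]; rfl
    exact sub_eq_zero.1 this
  have hAB := Submodule.finrank_sup_add_finrank_inf_eq A B
  have hinf : finrank ℝ (A ⊓ B : Submodule ℝ (EuclideanSpace ℝ D)) ≤ 1 := by
    refine finrank_le_one_of_constant ?_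
    rintro f ⟨hf1, hf2⟩ x y
    refine P.eq_of_invariant hf1 (fun x => ?_) x y
    have := hf2 x
    have h := hf1 (P.rot⁻¹ (P.opp x))
    rw [show P.rot (P.rot⁻¹ (P.opp x)) = P.opp x from P.rot.apply_symm_apply _] at h
    rw [h, ← this, Equiv.Perm.mul_apply]
  have horth := (A ⊔ B).finrank_add_finrank_orthogonal
  rw [finrank_euclideanSpace, two_mul_card_quotient P.opp_opp P.opp_ne] at horth
  have heuler := P.euler
  rw [finrank_invariantFunctions, ← hR] at hdimR
  rw [show finrank ℝ A = _ from finrank_invariantFunctions _,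
    show finrank ℝ B = _ from finrank_invariantFunctions _] at hAB
  -- With `V`, `E`, `F` double points, edges and faces: `dim R ≥ E - 1`, while `dim (A ⊔ B) ≥ V + F
  -- - 1` leaves at most `2E - (V + F - 1) = E - 1` for the orthogonal complement.
  have heq : R = (A ⊔ B)ᗮ := by
    refine Submodule.eq_of_le_of_finrank_le hRle ?_
    omega
  have hχ : WithLp.toLp 2 χ ∈ R := by
    rw [heq, ← Submodule.inf_orthogonal, Submodule.mem_inf, Submodule.mem_orthogonal,
      Submodule.mem_orthogonal]
    constructor
    · intro u hu
      rw [PiLp.inner_apply, ← h1 u hu]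
      simp [mul_comm]
    · intro u hu
      rw [PiLp.inner_apply, ← h2 u hu]
      simp [mul_comm]
  obtain ⟨f, hf⟩ := hχ
  refine ⟨f.1, f.2, fun x => ?_⟩
  have : P.coboundary f x = (WithLp.toLp 2 χ : EuclideanSpace ℝ D) x := by rw [hf]
  exact this

end Homology
end KnotProjection

/-! ### The two sides of a circle. -/

namespace KnotProjection

section Circle

variable {D : Type*} (P : KnotProjection D)

theorem sameRegion_noSplice_invariant {h : D → Prop}
    (hh : ∀ x, h ((P.rot⁻¹ * P.opp) x) ↔ h x) {x y : D} (hxy : P.SameRegion P.noSplice x y) :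
    h x ↔ h y := by
  induction hxy with
  | rel a b hab =>
    rcases hab with rfl | hab
    · exact (hh a).symm
    · exact absurd hab.1 (P.not_open_noSplice a)
  | refl => rfl
  | symm _ _ _ ih => exact ih.symm
  | trans _ _ _ _ _ ih1 ih2 => exact ih1.trans ih2

variable {P}

theorem SameRegion.symm {s : P.Splicing} {x y : D} (h : P.SameRegion s x y) :
    P.SameRegion s y x := Relation.EqvGen.symm _ _ h

theorem SameRegion.trans {s : P.Splicing} {x y z : D} (h : P.SameRegion s x y)
    (h' : P.SameRegion s y z) : P.SameRegion s x z := Relation.EqvGen.trans _ _ _ h h'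

theorem SameRegion.refl {s : P.Splicing} (x : D) : P.SameRegion s x x := Relation.EqvGen.refl _

theorem SameRegion.face {s : P.Splicing} (x : D) :
    P.SameRegion s x ((P.rot⁻¹ * P.opp) x) := .rel _ _ (Or.inl rfl)

theorem SameRegion.channel {s : P.Splicing} {x : D} (h : P.Open s x) :
    P.SameRegion s x (P.rot (P.rot x)) := .rel _ _ (Or.inr ⟨h, rfl⟩)

theorem SameRegion.of_noSplice {s : P.Splicing} {x y : D} (h : P.SameRegion P.noSplice x y) :
    P.SameRegion s x y := by
  induction h with
  | rel a b hab =>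
    rcases hab with rfl | hab
    · exact .face a
    · exact absurd hab.1 (P.not_open_noSplice a)
  | refl x => exact .refl x
  | symm _ _ _ ih => exact ih.symm
  | trans _ _ _ _ _ ih1 ih2 => exact ih1.trans ih2

variable (P)

/-- The dart `d` leaves one of the double points of `c`. -/
def OnCircle {k : ℕ} (c : Fin k → D) (d : D) : Prop := ∃ i, P.vertex d = P.vertex (c i)

/-- The dart to the right (`σ = true`) or left (`σ = false`) at the `i`-th double point. -/
def sideDart {k : ℕ} (c : Fin k → D) (σ : Bool) (i : Fin k) (b : Bool) : D :=
  if σ then P.rightDart c i b else P.leftDart c i b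

section

variable {k : ℕ} {c : Fin k → D}

@[simp] theorem onCircle_rot (x : D) : P.OnCircle c (P.rot x) ↔ P.OnCircle c x := by
  simp [OnCircle]

@[simp] theorem vertex_sideDart (σ : Bool) (i : Fin k) (b : Bool) :
    P.vertex (P.sideDart c σ i b) = P.vertex (c i) := by
  cases σ <;> cases b <;> simp [sideDart, leftDart, rightDart]

theorem onCircle_sideDart (σ : Bool) (i : Fin k) (b : Bool) :
    P.OnCircle c (P.sideDart c σ i b) := ⟨i, by simp⟩

theorem OnCircle.exists_sideDart {x : D} (h : P.OnCircle c x) :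
    ∃ σ i b, x = P.sideDart c σ i b := by
  obtain ⟨i, hi⟩ := h
  rcases P.eq_of_vertex_eq hi with h | h | h | h
  · exact ⟨true, i, false, by simpa [sideDart, rightDart] using h⟩
  · exact ⟨false, i, false, by simpa [sideDart, leftDart] using h⟩
  · exact ⟨false, i, true, by simpa [sideDart, leftDart] using h⟩
  · refine ⟨true, i, true, ?_⟩
    rw [h, ← rot_inv_apply]; simp [sideDart, rightDart]

theorem rot_two_sideDart (σ : Bool) (i : Fin k) (b : Bool) :
    P.rot (P.rot (P.sideDart c σ i b)) = P.sideDart c (!σ) i (!b) := by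
  cases σ <;> cases b <;> simp [sideDart, leftDart, rightDart, -Equiv.Perm.coe_inv,
    rot_inv_apply, P.rot_four]

theorem through_sideDart {s : P.Splicing} {i : Fin k} (h : P.Open s (c i)) (σ b : Bool) :
    P.through s (P.sideDart c σ i b) = P.sideDart c σ i (!b) := by
  have h2 := (P.open_rot_two s (c i)).2 h
  cases σ <;> cases b <;> simp only [sideDart, leftDart, rightDart, Bool.not_true, Bool.not_false,
    if_true, if_false, Bool.false_eq_true]
  · exact P.through_of_open_rot h2
  · rw [P.through_of_open h2, Equiv.Perm.inv_eq_iff_eq]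
  · exact P.through_of_open h
  · have : P.rot (P.rot⁻¹ (c i)) = c i := P.rot.apply_symm_apply _
    rw [P.through_of_open_rot] <;> rw [this]
    exact h

theorem sideDart_inj (hc : Function.Injective fun i => P.vertex (c i)) {σ σ' : Bool} {i i' : Fin k}
    {b b' : Bool} : P.sideDart c σ i b = P.sideDart c σ' i' b' ↔ σ = σ' ∧ i = i' ∧ b = b' := by
  constructor
  · intro h
    have hi : i = i' := hc (by simpa using congrArg P.vertex h)
    subst hi
    have h1 := P.rot_ne (c i)
    have h2 := P.rot_two_ne (c i)
    have h3 := P.rot_three_ne (c i)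
    have h12 := P.rot_ne (P.rot (c i))
    have h23 := P.rot_ne (P.rot (P.rot (c i)))
    have h13 := P.rot_two_ne (P.rot (c i))
    revert h
    cases σ <;> cases b <;> cases σ' <;> cases b' <;>
      simp only [sideDart, leftDart, rightDart, rot_inv_apply, if_true, if_false,
        Bool.false_eq_true] <;> intro h <;>
      first | exact absurd h (by assumption) | exact absurd h.symm (by assumption) | simp
  · rintro ⟨rfl, rfl, rfl⟩; rfl

end

variable {P}

/-- The two sides of a circle. -/
theorem IsCircle.exists_side {k : ℕ} [NeZero k] {c : Fin k → D} (hc : P.IsCircle c) (σ : Bool) :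
    ∃ S : Set D, (∀ x, P.opp x ∈ S ↔ x ∈ S) ∧ (∀ x, ¬ P.OnCircle c x → (P.rot x ∈ S ↔ x ∈ S)) ∧
      ∀ σ' i b, P.sideDart c σ' i b ∈ S ↔ σ' = σ := by
  classical
  have := P.finite
  have := Fintype.ofFinite D
  -- The signed crossings of the circle with the medial edges: turning from `c i` to `rot (c i)`
  -- passes from right to left, and at the opposite corner from left to right. The sums vanish
  -- around double points trivially, and around faces because the circle leaves each region that it
  -- enters.
  let χ : D → ℝ := fun x =>
    ∑ i, ((if x = c i then 1 else 0) - (if x = P.rot (P.rot (c i)) then 1 else 0))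
  have hsum : ∀ a : D → ℝ, ∑ x, a x * χ x = ∑ i, (a (c i) - a (P.rot (P.rot (c i)))) := by
    intro a
    simp only [χ, Finset.mul_sum]
    rw [Finset.sum_comm]
    simp [mul_sub, Finset.sum_sub_distrib]
  obtain ⟨F, hF1, hF2⟩ := P.exists_potential χ
    (fun a ha => by rw [hsum]; exact Finset.sum_eq_zero fun i _ => by rw [ha, ha, sub_self])
    (fun a ha => by
      rw [hsum, Finset.sum_sub_distrib, sub_eq_zero,
        ← Equiv.sum_comp (Equiv.addRight (1 : Fin k)) (fun i => a (P.rot (P.rot (c i))))]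
      refine Finset.sum_congr rfl fun i _ => ?_
      exact ((P.sameRegion_noSplice_invariant (h := fun y => a (c i) = a y) (fun x => by rw [ha])
        (hc.region_next i)).1 rfl))
  have hχ : ∀ i x, P.vertex x = P.vertex (c i) → χ x =
      (if x = c i then 1 else 0) - (if x = P.rot (P.rot (c i)) then 1 else 0) := by
    intro i x hx
    refine Finset.sum_eq_single i (fun j _ hj => ?_) (by simp)
    have : P.vertex x ≠ P.vertex (c j) := fun h => hj (hc.vertex_injective (h.symm.trans hx))
    rw [if_neg (by rintro rfl; exact this rfl), if_neg (by rintro rfl; simp at this), sub_zero]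
  have h0 : ∀ i, F (P.rot (c i)) = F (c i) + 1 := by
    intro i
    have := hF2 (c i)
    rw [hχ i _ rfl, if_pos rfl, if_neg (P.rot_two_ne _).symm] at this
    linarith
  have h1 : ∀ i, F (P.rot (P.rot (c i))) = F (c i) + 1 := by
    intro i
    have := hF2 (P.rot (c i))
    rw [hχ i _ (by simp), if_neg (P.rot_ne _), if_neg (P.rot_ne _).symm] at this
    linarith [h0 i]
  have h2 : ∀ i, F (P.rot (P.rot (P.rot (c i)))) = F (c i) := by
    intro i
    have := hF2 (P.rot (P.rot (c i)))
    rw [hχ i _ (by simp), if_neg (P.rot_two_ne _), if_pos rfl] at this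
    linarith [h1 i]
  have hstep : ∀ i, F (c (i + 1)) = F (c i) := by
    intro i
    let h : D → ℝ := fun x => if P.SameRegion P.noSplice (c i) x then 1 else 0
    have hinv : ∀ x, h ((P.rot⁻¹ * P.opp) x) = h x := by
      intro x
      have : P.SameRegion P.noSplice (c i) ((P.rot⁻¹ * P.opp) x) ↔
          P.SameRegion P.noSplice (c i) x :=
        ⟨fun h => h.trans (SameRegion.face x).symm, fun h => h.trans (SameRegion.face x)⟩
      simp only [h, this]
    -- Summing `F` around the region gives only `1 - 1 = 0`. For `F ^ 2` the two jumps contribute `2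
    -- * F (c i) + 1` and `-(2 * F (c (i + 1)) + 1)`, since the region meets the circle at no other
    -- corners; so the two values of `F` agree.
    have e := P.sum_face_eq_zero (h := h) (F := fun x => F x ^ 2) hinv (by simp [hF1])
    have e2 : ∑ x, (h x * (F (P.rot x) + F x)) * χ x = 0 := by
      rw [← e]
      refine Finset.sum_congr rfl fun x _ => ?_
      rw [← hF2]; ring
    have hh1 : ∀ j, h (c j) = if j = i then 1 else 0 := by
      intro j
      refine if_congr ⟨fun hj => ?_, ?_⟩ rfl rfl
      · by_contra hne
        exact hc.region_ne i j (Ne.symm hne) hj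
      · rintro rfl; exact .refl _
    have hh2 : ∀ j, h (P.rot (P.rot (c j))) = if j = i + 1 then 1 else 0 := by
      intro j
      have hn := hc.region_next (j - 1)
      rw [sub_add_cancel] at hn
      refine if_congr ⟨fun hj => ?_, ?_⟩ rfl rfl
      · by_contra hne
        exact hc.region_ne i (j - 1) (fun h => hne (by rw [h, sub_add_cancel]))
          (hj.trans hn.symm)
      · rintro rfl; exact hc.region_next i
    rw [hsum] at e2
    simp only [hh1, hh2, h0, h1, h2] at e2
    simp only [ite_mul, one_mul, zero_mul, Finset.sum_sub_distrib, Finset.sum_ite_eq',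
      Finset.mem_univ, if_true] at e2
    linarith
  have hconst : ∀ i, F (c i) = F (c 0) := by
    obtain ⟨m, rfl⟩ := Nat.exists_eq_succ_of_ne_zero (NeZero.ne k)
    intro i
    induction i using Fin.induction with
    | zero => rfl
    | succ i ih => rw [← Fin.coeSucc_eq_succ, hstep, ih]
  have hside : ∀ σ' i b, F (P.sideDart c σ' i b) = F (c 0) + if σ' then 0 else 1 := by
    intro σ' i b
    rw [← hconst i]
    cases σ' <;> cases b <;>
      simp only [sideDart, leftDart, rightDart, rot_inv_apply, if_true, if_false,
        Bool.false_eq_true, h0, h1, h2, add_zero]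
  -- The sides are level sets of the potential, which is one larger on the left than on the right.
  refine ⟨{x | F x = F (c 0) + if σ then 0 else 1}, fun x => ?_, fun x hx => ?_,
    fun σ' i b => ?_⟩
  · simp [hF1]
  · have hχ0 : χ x = 0 := by
      refine Finset.sum_eq_zero fun i _ => ?_
      have : P.vertex x ≠ P.vertex (c i) := fun h => hx ⟨i, h⟩
      rw [if_neg (by rintro rfl; exact this rfl), if_neg (by rintro rfl; simp at this), sub_zero]
    have : F (P.rot x) = F x := by linarith [hF2 x]
    simp [this]
  · simp only [Set.mem_ofPred_eq, hside]
    cases σ <;> cases σ' <;> simp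

/-- A union of components of a part of the curve that is separated from the rest at all double
points except for one pair of opposite corners: these lie in the same region. -/
theorem sameRegion_of_separated {S : Set D} (hS : ∀ x, P.opp x ∈ S ↔ x ∈ S) {w : D}
    (hw1 : w ∉ S) (hw2 : P.rot w ∈ S)
    (h : ∀ x, x ≠ w → x ≠ P.rot (P.rot w) → (P.rot x ∈ S ↔ x ∈ S)) :
    P.SameRegion P.noSplice w (P.rot (P.rot w)) := by
  classical
  have := P.finite
  have := Fintype.ofFinite D
  by_contra hne
  -- Around the region of the corner `w` the indicator of `S` jumps up at `w`. It must jump back,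
  -- and the only other corner where it can is the opposite one.
  have e := P.sum_face_eq_zero (h := fun x => if P.SameRegion P.noSplice w x then 1 else 0)
    (F := fun x => if x ∈ S then 1 else 0) (fun x => ?_) (by simp [hS])
  · rw [Finset.sum_eq_single w] at e
    · simp [hw1, hw2, SameRegion.refl w] at e
    · intro x _ hx
      by_cases hx2 : x = P.rot (P.rot w)
      · subst hx2; simp [hne]
      · simp [h x hx hx2]
    · simp
  · have : P.SameRegion P.noSplice w ((P.rot⁻¹ * P.opp) x) ↔ P.SameRegion P.noSplice w x :=
      ⟨fun h => h.trans (SameRegion.face x).symm, fun h => h.trans (SameRegion.face x)⟩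
    simp only [this]

end Circle
end KnotProjection

/-! ### Arcs between the points of a circle and the matchings they induce. -/

namespace KnotProjection

section Arc

variable {D : Type*} {P : KnotProjection D} {k : ℕ} {c : Fin k → D} {d e : D}

theorem ArcJoins.mem {S : Set D} (h : P.ArcJoins c d e) (h1 : ∀ x ∈ S, P.opp x ∈ S)
    (h2 : ∀ x ∈ S, ¬ P.OnCircle c x → P.rot (P.rot x) ∈ S) (hd : d ∈ S) : e ∈ S := by
  obtain ⟨n, rfl, -, hn⟩ := h
  have key : ∀ m ≤ n, (P.ahead ^ m) d ∈ S := by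
    intro m
    induction m with
    | zero => simpa using hd
    | succ m ih =>
      intro hm
      rw [pow_succ', Equiv.Perm.mul_apply, ahead_apply]
      exact h2 _ (h1 _ (ih (by omega))) (fun ⟨i, hi⟩ => hn m (by omega) i hi)
  exact h1 _ (key n le_rfl)

/-- The set of darts on an arc. -/
theorem ArcJoins.exists_set (hd : P.OnCircle c d) (h : P.ArcJoins c d e) :
    ∃ X : Set D, (∀ x, P.opp x ∈ X ↔ x ∈ X) ∧
      (∀ x, ¬ P.OnCircle c x → (P.rot (P.rot x) ∈ X ↔ x ∈ X)) ∧
      ∀ x, P.OnCircle c x → (x ∈ X ↔ x = d ∨ x = e) := by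
  obtain ⟨n, rfl, he, hn⟩ := h
  let X : Set D := {x | ∃ m ≤ n, x = (P.ahead ^ m) d ∨ x = P.opp ((P.ahead ^ m) d)}
  have h1 : ∀ x ∈ X, P.opp x ∈ X := by
    rintro x ⟨m, hm, rfl | rfl⟩
    · exact ⟨m, hm, Or.inr rfl⟩
    · exact ⟨m, hm, Or.inl (P.opp_opp _)⟩
  have hsucc : ∀ m, (P.ahead ^ (m + 1)) d = P.rot (P.rot (P.opp ((P.ahead ^ m) d))) := by
    intro m
    rw [pow_succ', Equiv.Perm.mul_apply, ahead_apply]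
  have h2 : ∀ x ∈ X, ¬ P.OnCircle c x → P.rot (P.rot x) ∈ X := by
    rintro x ⟨m, hm, rfl | rfl⟩ hx
    · obtain _ | m := m
      · exact absurd hd hx
      · exact ⟨m, by omega, Or.inr (by rw [hsucc, P.rot_four])⟩
    · rcases hm.eq_or_lt with rfl | hm
      · exact absurd he hx
      · exact ⟨m + 1, hm, Or.inl (hsucc m).symm⟩
  refine ⟨X, fun x => ⟨fun h => ?_, h1 x⟩, fun x hx => ⟨fun h => ?_, fun h => h2 x h hx⟩,
    fun x hx => ⟨?_, ?_⟩⟩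
  · simpa [P.opp_opp] using h1 _ h
  · simpa [P.rot_four] using h2 _ h (by simpa using hx)
  · rintro ⟨m, hm, rfl | rfl⟩
    · obtain _ | m := m
      · exact Or.inl rfl
      · rw [hsucc, onCircle_rot, onCircle_rot] at hx
        obtain ⟨i, hi⟩ := hx
        exact absurd hi (hn m hm i)
    · rcases hm.eq_or_lt with rfl | hm
      · exact Or.inr rfl
      · obtain ⟨i, hi⟩ := hx
        exact absurd hi (hn m hm i)
  · rintro (rfl | rfl)
    · exact ⟨0, Nat.zero_le _, Or.inl rfl⟩
    · exact ⟨n, le_rfl, Or.inr rfl⟩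

theorem ArcJoins.onCircle (h : P.ArcJoins c d e) : P.OnCircle c e := by
  obtain ⟨n, rfl, he, -⟩ := h
  exact he

theorem OnCircle.exists_arcJoins (hd : P.OnCircle c d) : ∃ e, P.ArcJoins c d e := by
  classical
  have := P.finite
  have hex : ∃ n, P.OnCircle c (P.opp ((P.ahead ^ n) d)) := by
    -- The traversal is periodic; the last step before it returns to `d` arrives at the double point
    -- of `d`.
    have hn := orderOf_pos P.ahead
    refine ⟨orderOf P.ahead - 1, ?_⟩
    have : (P.ahead ^ (orderOf P.ahead - 1 + 1)) d = d := by
      rw [Nat.sub_add_cancel hn, pow_orderOf_eq_one]; rfl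
    rw [pow_succ', Equiv.Perm.mul_apply, ahead_apply] at this
    rw [← onCircle_rot, ← onCircle_rot, this]
    exact hd
  exact ⟨_, Nat.find hex, rfl, Nat.find_spec hex,
    fun m hm i hi => Nat.find_min hex hm ⟨i, hi⟩⟩

/-- Otherwise `d` would be the only dart of the arc on the circle, against the parity argument of
`apply_mem_of_involutions`. -/
theorem ArcJoins.ne (hd : P.OnCircle c d) (h : P.ArcJoins c d e) : e ≠ d := by
  rintro rfl
  have := P.finite
  obtain ⟨X, h1, h2, h3⟩ := h.exists_set hd
  have hX : ∀ x ∈ X, x ≠ e → P.rot (P.rot x) ∈ X := by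
    intro x hx hne
    refine (h2 x fun hon => hne ?_).2 hx
    simpa using (h3 x hon).1 hx
  have := apply_mem_of_involutions (S := X) (σ := P.opp) (τ := fun x => P.rot (P.rot x)) P.opp_opp
    P.opp_ne P.rot_four P.rot_two_ne (a := e) ((h3 e hd).2 (Or.inl rfl)) (fun x hx => (h1 x).2 hx) hX
  have := (h3 _ (by simpa using hd)).1 this
  simp [P.rot_two_ne] at this

theorem ArcJoins.unique (hd : P.OnCircle c d) {e' : D} (h : P.ArcJoins c d e)
    (h' : P.ArcJoins c d e') : e' = e := by
  obtain ⟨X, h1, h2, h3⟩ := h.exists_set hd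
  have := h'.mem (S := X) (fun x hx => (h1 x).2 hx) (fun x hx hx' => (h2 x hx').2 hx)
    ((h3 d hd).2 (Or.inl rfl))
  exact ((h3 _ h'.onCircle).1 this).resolve_left (h'.ne hd)

/-- The arc starting at `e` stays in the dart set of the given arc, whose only darts on the circle
are `d` and `e`, and it cannot end at `e`. -/
theorem ArcJoins.symm (hd : P.OnCircle c d) (h : P.ArcJoins c d e) : P.ArcJoins c e d := by
  obtain ⟨X, h1, h2, h3⟩ := h.exists_set hd
  obtain ⟨e', h'⟩ := h.onCircle.exists_arcJoins
  have := h'.mem (S := X) (fun x hx => (h1 x).2 hx) (fun x hx hx' => (h2 x hx').2 hx)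
    ((h3 e h.onCircle).2 (Or.inr rfl))
  have := ((h3 _ h'.onCircle).1 this).resolve_right (h'.ne h.onCircle)
  rwa [← this]

/-- The curve contains more than two arcs that continue each other at both ends. -/
theorem ArcJoins.eq_of_opposite_arc (hd : P.OnCircle c d) (h : P.ArcJoins c d e)
    (h' : P.ArcJoins c (P.rot (P.rot d)) (P.rot (P.rot e))) {y : D} (hy : P.OnCircle c y) :
    y = d ∨ y = e ∨ y = P.rot (P.rot d) ∨ y = P.rot (P.rot e) := by
  obtain ⟨X, h1, h2, h3⟩ := h.exists_set hd
  obtain ⟨X', h1', h2', h3'⟩ := h'.exists_set (by simpa using hd)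
  have := P.mem_of_closed (S := X ∪ X') (x := d) ?_ ?_ (Or.inl ((h3 d hd).2 (Or.inl rfl))) y
  · rw [Set.mem_union, h3 y hy, h3' y hy] at this
    tauto
  · intro x hx
    rwa [Set.mem_union, h1, h1']
  · intro x hx
    by_cases hon : P.OnCircle c x
    · rw [Set.mem_union, h3 x hon, h3' x hon] at hx
      rw [Set.mem_union, h3 _ (by simpa using hon), h3' _ (by simpa using hon)]
      rcases hx with (rfl | rfl) | (rfl | rfl) <;> simp [P.rot_four]
    · rwa [Set.mem_union, h2 x hon, h2' x hon]

/-- On each side of the circle the arcs match the branches. -/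
theorem IsCircle.exists_matching [NeZero k] (hc : P.IsCircle c) (σ : Bool) :
    ∃ m : Fin k × Bool → Fin k × Bool, ∀ p q,
      P.ArcJoins c (P.sideDart c σ p.1 p.2) (P.sideDart c σ q.1 q.2) ↔ m p = q := by
  obtain ⟨S, h1, h2, h3⟩ := hc.exists_side σ
  have : ∀ p : Fin k × Bool, ∃ q : Fin k × Bool,
      P.ArcJoins c (P.sideDart c σ p.1 p.2) (P.sideDart c σ q.1 q.2) := by
    intro p
    obtain ⟨e, he⟩ := (P.onCircle_sideDart (c := c) σ p.1 p.2).exists_arcJoins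
    have heS := he.mem (S := S) (fun x hx => (h1 x).2 hx)
      (fun x hx hx' => (h2 _ (by simpa using hx')).2 ((h2 x hx').2 hx)) ((h3 _ _ _).2 rfl)
    obtain ⟨σ', i, b, rfl⟩ := he.onCircle.exists_sideDart
    rw [h3] at heS
    subst heS
    exact ⟨(i, b), he⟩
  choose m hm using this
  refine ⟨m, fun p q => ⟨fun h => ?_, ?_⟩⟩
  · have := h.unique (P.onCircle_sideDart _ _ _) (hm p)
    rw [sideDart_inj P hc.vertex_injective] at this
    exact Prod.ext this.2.1 this.2.2
  · rintro rfl
    exact hm p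

theorem matching_symm {m : Fin k × Bool → Fin k × Bool} {σ : Bool} (hm : ∀ p q,
      P.ArcJoins c (P.sideDart c σ p.1 p.2) (P.sideDart c σ q.1 q.2) ↔ m p = q) (p : Fin k × Bool) :
    m (m p) = p := by
  rw [← hm]
  exact ((hm p (m p)).2 rfl).symm (P.onCircle_sideDart _ _ _)

theorem matching_ne {m : Fin k × Bool → Fin k × Bool} {σ : Bool} (hm : ∀ p q,
      P.ArcJoins c (P.sideDart c σ p.1 p.2) (P.sideDart c σ q.1 q.2) ↔ m p = q) (p : Fin k × Bool) :
    m p ≠ p := by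
  intro h
  exact ((hm p p).2 h).ne (P.onCircle_sideDart _ _ _) rfl

/-- A set that contains all or none of the branches at the circle and is closed outside of the
circle is trivial. -/
theorem mem_of_closed_off_circle {S : Set D} (h1 : ∀ x ∈ S, P.opp x ∈ S)
    (h2 : ∀ x ∈ S, ¬ P.OnCircle c x → P.rot (P.rot x) ∈ S)
    (h3 : ∀ x y, P.OnCircle c x → P.OnCircle c y → x ∈ S → y ∈ S) {x : D} (hx : x ∈ S) (y : D) :
    y ∈ S := by
  refine P.mem_of_closed h1 (fun z hz => ?_) hx y
  by_cases hon : P.OnCircle c z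
  · exact h3 z _ hon (by simpa using hon) hz
  · exact h2 z hz hon

end Arc
end KnotProjection

/-! ### Perfect matchings of the branches on one side, for two and three points. -/

namespace KnotProjection

section Matching

theorem matching_two (m : Fin 2 × Bool → Fin 2 × Bool) (h1 : ∀ p, m (m p) = p)
    (h2 : ∀ p, m p ≠ p) :
    (∀ i, m (i, false) = (i, true)) ∨ (∀ b, m (0, b) = (1, !b)) ∨ (∀ b, m (0, b) = (1, b)) := by
  have a1 := h1 (0, false)
  have a2 := h1 (0, true)
  have a3 := h1 (1, false)
  have b1 := h2 (0, false)
  have b2 := h2 (0, true)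
  have b3 := h2 (1, false)
  rcases e1 : m (0, false) with ⟨i, _ | _⟩ <;> rcases e2 : m (0, true) with ⟨j, _ | _⟩ <;>
    rcases e3 : m (1, false) with ⟨k, _ | _⟩ <;> fin_cases i <;> fin_cases j <;> fin_cases k <;>
    simp_all [Fin.forall_fin_two]

/-- If both branches at `i` went to `j`, they would use up both branches at `j`, and the third point
would be matched with itself. So each point is matched once with each of the others; `l i` is the
branch that goes to `i + 1`. -/
theorem matching_three (m : Fin 3 × Bool → Fin 3 × Bool) (h1 : ∀ p, m (m p) = p)
    (h2 : ∀ p, (m p).1 ≠ p.1) : ∃ l : Fin 3 → Bool, ∀ i, m (i, l i) = (i + 1, !l (i + 1)) := by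
  have key : ∀ i j, i ≠ j → ∃ b, (m (i, b)).1 ≠ j := by
    intro i j hij
    by_contra! h
    have hj : ∀ b, (m (j, b)).1 = i := by
      intro b
      have hne : (m (i, false)).2 ≠ (m (i, true)).2 := by
        intro h'
        have : m (i, false) = m (i, true) := Prod.ext ((h _).trans (h _).symm) h'
        have := congrArg m this
        simp [h1] at this
      have : ∃ b', (m (i, b')).2 = b := by
        by_contra! h'
        have e : ∀ x y b : Bool, x ≠ y → x ≠ b → y ≠ b → False := by decide
        exact e _ _ b hne (h' false) (h' true)
      obtain ⟨b', hb'⟩ := this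
      have : (j, b) = m (i, b') := Prod.ext (h b').symm hb'.symm
      rw [this, h1]
    obtain ⟨k, hki, hkj⟩ : ∃ k : Fin 3, k ≠ i ∧ k ≠ j := by
      have e : ∀ i j : Fin 3, ∃ k : Fin 3, k ≠ i ∧ k ≠ j := by decide
      exact e i j
    have h3 : (m (k, false)).1 = i ∨ (m (k, false)).1 = j := by
      have e : ∀ i j k x : Fin 3, i ≠ j → k ≠ i → k ≠ j → x ≠ k → x = i ∨ x = j := by decide
      exact e i j k _ hij hki hkj (h2 (k, false))
    have h4 := congrArg Prod.fst (h1 (k, false))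
    rcases h3 with h3 | h3
    · rw [← Prod.mk.eta (p := m (k, false)), h3, h] at h4
      exact hkj h4.symm
    · rw [← Prod.mk.eta (p := m (k, false)), h3, hj] at h4
      exact hki h4.symm
  have hnext : ∀ i, ∃ b, (m (i, b)).1 = i + 1 ∧ (m (i, !b)).1 = i + 2 := by
    intro i
    obtain ⟨b, hb⟩ := key i (i + 2) (by simp)
    obtain ⟨b', hb'⟩ := key i (i + 1) (by simp)
    have e : ∀ i x : Fin 3, x ≠ i → x ≠ i + 2 → x = i + 1 := by decide
    have e' : ∀ i x : Fin 3, x ≠ i → x ≠ i + 1 → x = i + 2 := by decide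
    have hbi := e i _ (h2 (i, b)) hb
    refine ⟨b, hbi, ?_⟩
    have : b' = !b := by
      rw [Bool.eq_not]
      rintro rfl
      exact hb' hbi
    rw [← this]
    exact e' i _ (h2 (i, b')) hb'
  choose l hl hl' using hnext
  refine ⟨l, fun i => Prod.ext (hl i) ?_⟩
  rw [Bool.eq_not]
  intro h
  have : m (i, l i) = (i + 1, l (i + 1)) := Prod.ext (hl i) h
  have := congrArg m this
  rw [h1] at this
  have h3 := hl (i + 1)
  rw [← this] at h3
  have e : ∀ i : Fin 3, i ≠ i + 1 + 1 := by decide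
  exact e i h3

end Matching

/-! ### The possible pictures of circles, and circles obtained from nugatory crossings. -/

section Circles

variable {D : Type*} {P : KnotProjection D}

theorem IsCircle.two_types {c : Fin 2 → D} (hc : P.IsCircle c) (σ : Bool) :
    (∀ i, P.ArcJoins c (P.sideDart c σ i false) (P.sideDart c σ i true)) ∨
    (∀ b, P.ArcJoins c (P.sideDart c σ 0 b) (P.sideDart c σ 1 (!b))) ∨
    (∀ b, P.ArcJoins c (P.sideDart c σ 0 b) (P.sideDart c σ 1 b)) := by
  obtain ⟨m, hm⟩ := hc.exists_matching σ
  rcases matching_two m (matching_symm hm) (matching_ne hm) with h | h | h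
  · exact Or.inl fun i => (hm (i, false) (i, true)).2 (h i)
  · exact Or.inr (Or.inl fun b => (hm (0, b) (1, !b)).2 (h b))
  · exact Or.inr (Or.inr fun b => (hm (0, b) (1, b)).2 (h b))

/-- Reversing the circle exchanges left with right and forward with backward. For two points the
reversed cyclic order is the same, so no reindexing is needed. -/
theorem sideDart_reverse {c : Fin 2 → D} (σ : Bool) (i : Fin 2) (b : Bool) :
    P.sideDart (fun i => P.rot (P.rot (c i))) σ i b = P.sideDart c (!σ) i (!b) := by
  cases σ <;> cases b <;> simp [sideDart, leftDart, rightDart, -Equiv.Perm.coe_inv,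
    rot_inv_apply, P.rot_four]

theorem add_one_add_one_fin_two : ∀ i : Fin 2, i + 1 + 1 = i := by decide

theorem arcJoins_reverse {c : Fin 2 → D} {d e : D} :
    P.ArcJoins (fun i => P.rot (P.rot (c i))) d e ↔ P.ArcJoins c d e := by
  simp [ArcJoins]

theorem arcJoins_reverse_sideDart {c : Fin 2 → D} {σ : Bool} {i j : Fin 2} {b b' : Bool}
    (h : P.ArcJoins c (P.sideDart c (!σ) i (!b)) (P.sideDart c (!σ) j (!b'))) :
    P.ArcJoins (fun i => P.rot (P.rot (c i))) (P.sideDart (fun i => P.rot (P.rot (c i))) σ i b)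
      (P.sideDart (fun i => P.rot (P.rot (c i))) σ j b') := by
  rwa [arcJoins_reverse, sideDart_reverse, sideDart_reverse]

theorem IsCircle.reverse {c : Fin 2 → D} (hc : P.IsCircle c) :
    P.IsCircle fun i => P.rot (P.rot (c i)) where
  vertex_injective := by simpa using hc.vertex_injective
  region_next i := by
    have := (hc.region_next (i + 1)).symm
    rw [add_one_add_one_fin_two] at this
    rwa [P.rot_four]
  region_ne i j hij h := by
    have h1 := hc.region_next (i + 1)
    have h2 := hc.region_next (j + 1)
    rw [add_one_add_one_fin_two] at h1
    rw [add_one_add_one_fin_two] at h2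
    exact hc.region_ne _ _ (by simpa using hij) (h1.trans (h.trans h2.symm))

/-- Every circle through two double points shows interlaced or parallel arcs. -/
theorem IsCircle.interlaced_or_parallel {c : Fin 2 → D} (hc : P.IsCircle c) :
    P.HasInterlacedTwoCircle ∨ P.HasParallelTwoCircle ∧
      ∃ σ, ∀ i, P.ArcJoins c (P.sideDart c σ i false) (P.sideDart c σ i true) := by
  have hinj := hc.vertex_injective
  have hon := P.onCircle_sideDart (c := c)
  -- Nine pairs of pictures. In the three pairs of equal pictures two arcs continue each other into
  -- a closed curve that misses some branches. The others are interlaced or parallel, possibly after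
  -- reversing the circle.
  rcases hc.two_types false with h1 | h1 | h1 <;> rcases hc.two_types true with h2 | h2 | h2
  · have := (h1 0).eq_of_opposite_arc (hon _ _ _)
      (by simpa [rot_two_sideDart] using (h2 0).symm (hon _ _ _)) (hon false 1 false)
    simp [rot_two_sideDart, sideDart_inj P hinj] at this
  · exact Or.inr ⟨⟨c, hc, h1, Or.inl h2⟩, false, h1⟩
  · exact Or.inr ⟨⟨c, hc, h1, Or.inr h2⟩, false, h1⟩
  · refine Or.inr ⟨⟨_, hc.reverse, fun i => ?_, Or.inl fun b => ?_⟩, true, h2⟩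
    · exact arcJoins_reverse_sideDart (σ := false) (b := false) (b' := true)
        ((h2 i).symm (hon _ _ _))
    · exact arcJoins_reverse_sideDart (σ := true) (b := b) (b' := !b)
        (by simpa using h1 (!b))
  · have := (h1 false).eq_of_opposite_arc (hon _ _ _)
      (by simpa [rot_two_sideDart] using h2 true) (hon false 0 true)
    simp [rot_two_sideDart, sideDart_inj P hinj] at this
  · exact Or.inl ⟨c, hc, h1, h2⟩
  · refine Or.inr ⟨⟨_, hc.reverse, fun i => ?_, Or.inr fun b => ?_⟩, true, h2⟩
    · exact arcJoins_reverse_sideDart (σ := false) (b := false) (b' := true)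
        ((h2 i).symm (hon _ _ _))
    · exact arcJoins_reverse_sideDart (σ := true) (b := b) (b' := b)
        (by simpa using h1 (!b))
  · refine Or.inl ⟨_, hc.reverse, fun b => ?_, fun b => ?_⟩
    · exact arcJoins_reverse_sideDart (σ := false) (b := b) (b' := !b)
        (by simpa using h2 (!b))
    · exact arcJoins_reverse_sideDart (σ := true) (b := b) (b' := b)
        (by simpa using h1 (!b))
  · have := (h1 false).eq_of_opposite_arc (hon _ _ _)
      (by simpa [rot_two_sideDart] using h2 true) (hon false 0 true)
    simp [rot_two_sideDart, sideDart_inj P hinj] at this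

/-- If splices at `c i` along the circle leave one component, then no arc joins `c i` to itself on
one side. -/
theorem not_arcJoins_self {k : ℕ} {c : Fin k → D}
    (hinj : Function.Injective fun i => P.vertex (c i)) {s : P.Splicing}
    (hcomp : ∀ d e, P.SameComponent s d e)
    (hsupp : ∀ x, s (P.vertex x) ≠ none → P.OnCircle c x) {i j : Fin k} (hij : j ≠ i)
    (hi : P.Open s (c i)) (σ : Bool) (b : Bool) :
    ¬ P.ArcJoins c (P.sideDart c σ i b) (P.sideDart c σ i (!b)) := by
  intro h
  obtain ⟨X, h1, h2, h3⟩ := h.exists_set (P.onCircle_sideDart _ _ _)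
  -- The splice at `c i` joins the two ends of the arc, making it a component that misses `c j`.
  have hmem := (P.sameComponent_iff s).1 hcomp X (fun x hx => (h1 x).2 hx) (fun x hx => ?_) _
    ((h3 _ (P.onCircle_sideDart _ _ _)).2 (Or.inl rfl)) (P.sideDart c σ j b)
  · rw [h3 _ (P.onCircle_sideDart _ _ _), sideDart_inj P hinj, sideDart_inj P hinj] at hmem
    simp [hij] at hmem
  · by_cases hon : P.OnCircle c x
    · rw [h3 _ hon] at hx
      rw [h3 _ (by simpa [OnCircle, vertex_through] using hon)]
      rcases hx with rfl | rfl
      · exact Or.inr (P.through_sideDart hi _ _)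
      · exact Or.inl (by rw [P.through_sideDart hi, Bool.not_not])
    · have : s (P.vertex x) = none := by
        by_contra h; exact hon (hsupp x h)
      rw [P.through_of_none this]
      exact (h2 x hon).2 hx

/-- If splices along the circle at all of its points except for `c 0` leave one component, then no
arc joins `c 0` to itself on one side. -/
theorem IsCircle.not_arcJoins_zero {k : ℕ} [NeZero k] {c : Fin k → D} (hc : P.IsCircle c)
    {s : P.Splicing} (hcomp : ∀ d e, P.SameComponent s d e)
    (hsupp : ∀ x, s (P.vertex x) ≠ none → P.OnCircle c x) {j : Fin k} (hj : j ≠ 0)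
    (hopen : ∀ i, i ≠ 0 → P.Open s (c i)) (σ : Bool) (b : Bool) :
    ¬ P.ArcJoins c (P.sideDart c σ 0 b) (P.sideDart c σ 0 (!b)) := by
  intro h
  have hinj := hc.vertex_injective
  obtain ⟨X, h1, h2, h3⟩ := h.exists_set (P.onCircle_sideDart _ _ _)
  obtain ⟨S, hS1, hS2, hS3⟩ := hc.exists_side σ
  -- The arc uses up both branches at `c 0` on this side, and at every other point the splice stays
  -- on its side. So the rest of the side is closed.
  have hmem := (P.sameComponent_iff s).1 hcomp (S \ X) (fun x hx => ?_) (fun x hx => ?_)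
    (P.sideDart c σ j b) ⟨(hS3 _ _ _).2 rfl, ?_⟩ (P.sideDart c σ 0 b)
  · exact hmem.2 ((h3 _ (P.onCircle_sideDart _ _ _)).2 (Or.inl rfl))
  · rwa [Set.mem_sdiff, hS1, h1]
  · by_cases hon : P.OnCircle c x
    · obtain ⟨σ', i, b', rfl⟩ := hon.exists_sideDart
      obtain ⟨hxS, hxX⟩ := hx
      rw [h3 _ hon, sideDart_inj P hinj, sideDart_inj P hinj] at hxX
      obtain rfl := (hS3 _ _ _).1 hxS
      have hi : i ≠ 0 := by
        rintro rfl
        revert hxX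
        cases b <;> cases b' <;> simp
      rw [P.through_sideDart (hopen i hi)]
      refine ⟨(hS3 _ _ _).2 rfl, ?_⟩
      rw [h3 _ (P.onCircle_sideDart _ _ _), sideDart_inj P hinj, sideDart_inj P hinj]
      simp [hi]
    · have : s (P.vertex x) = none := by
        by_contra h; exact hon (hsupp x h)
      rw [P.through_of_none this, Set.mem_sdiff, h2 x hon, hS2 _ (by simpa using hon), hS2 _ hon]
      exact hx
  · rw [h3 _ (P.onCircle_sideDart _ _ _), sideDart_inj P hinj, sideDart_inj P hinj]
    simp [hj]

/-- A circle through three double points, two of which may be spliced along it without disconnecting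
the curve, has one of the pictures of `HasThreeCircle`. -/
theorem IsCircle.hasThreeCircle {c : Fin 3 → D} (hc : P.IsCircle c)
    {s : P.Splicing} (hcomp : ∀ d e, P.SameComponent s d e)
    (hsupp : ∀ x, s (P.vertex x) ≠ none → P.OnCircle c x)
    (hopen : ∀ i, i ≠ 0 → P.Open s (c i)) : P.HasThreeCircle := by
  have hinj := hc.vertex_injective
  have hside : ∀ σ, ∃ l : Fin 3 → Bool, ∀ i,
      P.ArcJoins c (P.sideDart c σ i (l i)) (P.sideDart c σ (i + 1) (!(l (i + 1)))) := by
    intro σ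
    obtain ⟨m, hm⟩ := hc.exists_matching σ
    have hne : ∀ p, (m p).1 ≠ p.1 := by
      intro p hp
      have h2 : (m p).2 = !p.2 := by
        rw [Bool.eq_not]
        exact fun h => matching_ne hm p (Prod.ext hp h)
      have h3 : P.ArcJoins c (P.sideDart c σ p.1 p.2) (P.sideDart c σ p.1 (!p.2)) :=
        (hm p (p.1, !p.2)).2 (Prod.ext hp h2)
      by_cases hp0 : p.1 = 0
      · rw [hp0] at h3
        exact hc.not_arcJoins_zero hcomp hsupp (j := 1) (by decide) hopen _ _ h3
      · exact not_arcJoins_self hinj hcomp hsupp (Ne.symm hp0) (hopen _ hp0) _ _ h3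
    obtain ⟨l, hl⟩ := matching_three m (matching_symm hm) hne
    exact ⟨l, fun i => (hm (i, l i) (i + 1, !l (i + 1))).2 (hl i)⟩
  obtain ⟨l, hl⟩ := hside false
  obtain ⟨r, hr⟩ := hside true
  -- If `l` and `r` differ at two points, the left and right arcs between these continue each other
  -- into a closed curve that misses the third point.
  have hpair : ∀ i, l i ≠ r i → l (i + 1) ≠ r (i + 1) → False := by
    intro i h1 h2
    have h3 := hr i
    rw [Bool.eq_not.2 (Ne.symm h1), Bool.eq_not.2 (Ne.symm h2)] at h3
    have := (hl i).eq_of_opposite_arc (P.onCircle_sideDart _ _ _)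
      (by simpa [rot_two_sideDart] using h3) (P.onCircle_sideDart false (i + 2) false)
    simp [rot_two_sideDart, sideDart_inj P hinj] at this
  refine ⟨c, hc, l, r, hl, hr, ?_⟩
  by_cases h : l = r
  · exact Or.inl h
  · obtain ⟨i, hi⟩ := Function.ne_iff.1 h
    refine Or.inr ⟨i, hi, fun j hj => ?_⟩
    have e : ∀ i j : Fin 3, j = i ∨ j = i + 1 ∨ i = j + 1 := by decide
    rcases e i j with h | rfl | rfl
    · exact h
    · exact (hpair i hi hj).elim
    · exact (hpair j hj hi).elim

/-- A nugatory crossing of the spliced curve that none of `P` gives a circle. -/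
theorem exists_isCircle {s : P.Splicing}
    (hs : ∀ x y z, s (P.vertex x) ≠ none → s (P.vertex y) ≠ none → s (P.vertex z) ≠ none →
      P.vertex x ≠ P.vertex y → P.vertex z = P.vertex x ∨ P.vertex z = P.vertex y)
    {d : D} (hd : s (P.vertex d) = none) (h : P.SameRegion s d (P.rot (P.rot d)))
    (hno : ¬ P.SameRegion P.noSplice d (P.rot (P.rot d))) :
    (∃ w, P.Open s w ∧ P.IsCircle ![d, w]) ∨
    (∃ w₁ w₂, P.Open s w₁ ∧ P.Open s w₂ ∧ P.IsCircle ![d, w₁, w₂]) := by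
  set R := P.SameRegion P.noSplice with hR
  have hne : ∀ w, P.Open s w → P.vertex d ≠ P.vertex w := by
    intro w hw h
    exact Open.ne_none P hw (h ▸ hd)
  have two : ∀ w, P.Open s w → R d (P.rot (P.rot w)) → R w (P.rot (P.rot d)) →
      P.IsCircle ![d, w] := by
    intro w hw h1 h2
    have h3 : ¬ R d w := fun h => hno (h.trans h2)
    refine ⟨?_, ?_, ?_⟩
    · intro i j
      fin_cases i <;> fin_cases j <;> simp [hne w hw, (hne w hw).symm]
    · intro i
      fin_cases i
      · exact h1
      · exact h2
    · intro i j
      fin_cases i <;> fin_cases j <;> intro hij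
      · exact absurd rfl hij
      · exact h3
      · exact fun h => h3 h.symm
      · exact absurd rfl hij
  have hvert : ∀ x w, P.Open s x → P.Open s w → P.vertex x = P.vertex w →
      x = w ∨ x = P.rot (P.rot w) := by
    intro x w hx hw hxw
    have hw' := (P.open_rot_two s w).2 hw
    rcases P.eq_of_vertex_eq hxw with h | rfl | h | rfl
    · exact Or.inl h
    · exact absurd hw ((P.open_rot s w (Open.ne_none P hw)).1 hx)
    · exact Or.inr h
    · exact absurd hw' ((P.open_rot s _ (Open.ne_none P hw')).1 hx)
  -- The corners reached from `d` through at most two channels, at distinct double points. As at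
  -- most two double points are spliced, `T` is closed under channels, so it contains the whole
  -- region of `d`.
  let T : Set D := {x | R d x ∨ (∃ w, P.Open s w ∧ R d (P.rot (P.rot w)) ∧ R w x) ∨
    ∃ w₁ w₂, P.Open s w₁ ∧ P.Open s w₂ ∧ P.vertex w₁ ≠ P.vertex w₂ ∧ R d (P.rot (P.rot w₁)) ∧
      R w₁ (P.rot (P.rot w₂)) ∧ R w₂ x}
  have hT1 : ∀ x y, R x y → x ∈ T → y ∈ T := by
    rintro x y hxy (h | ⟨w, hw, h1, h2⟩ | ⟨w₁, w₂, h1, h2, h3, h4, h5, h6⟩)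
    · exact Or.inl (h.trans hxy)
    · exact Or.inr (Or.inl ⟨w, hw, h1, h2.trans hxy⟩)
    · exact Or.inr (Or.inr ⟨w₁, w₂, h1, h2, h3, h4, h5, h6.trans hxy⟩)
  have hT2 : ∀ x, P.Open s x → x ∈ T → P.rot (P.rot x) ∈ T := by
    have hin1 : ∀ w, P.Open s w → R d (P.rot (P.rot w)) → w ∈ T ∧ P.rot (P.rot w) ∈ T :=
      fun w hw h => ⟨Or.inr (Or.inl ⟨w, hw, h, .refl _⟩), Or.inl h⟩
    have hsw : ∀ x w, P.Open s x → P.Open s w → P.vertex x = P.vertex w →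
        w ∈ T ∧ P.rot (P.rot w) ∈ T → P.rot (P.rot x) ∈ T := by
      intro x w hx hw hxw hT
      rcases hvert x w hx hw hxw with rfl | rfl
      · exact hT.2
      · rw [P.rot_four]; exact hT.1
    rintro x hx (h | ⟨w, hw, h1, h2⟩ | ⟨w₁, w₂, h1, h2, h3, h4, h5, h6⟩)
    · exact Or.inr (Or.inl ⟨_, (P.open_rot_two s x).2 hx, by rwa [P.rot_four], .refl _⟩)
    · by_cases hxw : P.vertex x = P.vertex w
      · exact hsw x w hx hw hxw (hin1 w hw h1)
      · exact Or.inr (Or.inr ⟨w, _, hw, (P.open_rot_two s x).2 hx, by simpa using Ne.symm hxw, h1,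
          by rwa [P.rot_four], .refl _⟩)
    · rcases hs w₁ w₂ x (Open.ne_none P h1) (Open.ne_none P h2) (Open.ne_none P hx) h3 with hv | hv
      · exact hsw x w₁ hx h1 hv (hin1 w₁ h1 h4)
      · exact hsw x w₂ hx h2 hv ⟨Or.inr (Or.inr ⟨w₁, w₂, h1, h2, h3, h4, h5, .refl _⟩),
          Or.inr (Or.inl ⟨w₁, h1, h4, h5⟩)⟩
  have key : ∀ x y, P.SameRegion s x y → (x ∈ T ↔ y ∈ T) := by
    intro x y h
    induction h with
    | rel x y h =>
      rcases h with rfl | ⟨h, rfl⟩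
      · exact ⟨hT1 _ _ (.face x), hT1 _ _ (SameRegion.symm (.face x))⟩
      · refine ⟨hT2 x h, fun h' => ?_⟩
        simpa [P.rot_four] using hT2 _ ((P.open_rot_two s x).2 h) h'
    | refl => rfl
    | symm _ _ _ ih => exact ih.symm
    | trans _ _ _ _ _ ih1 ih2 => exact ih1.trans ih2
  rcases (key _ _ h).1 (Or.inl (.refl _)) with h | ⟨w, hw, h1, h2⟩ | ⟨w₁, w₂, h1, h2, h3, h4, h5, h6⟩
  · exact absurd h hno
  · exact Or.inl ⟨w, hw, two w hw h1 h2⟩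
  -- If the path visits a region twice, a shortcut leaves a circle through two points; otherwise the
  -- three regions are distinct.
  · by_cases e1 : R d w₁
    · exact Or.inl ⟨w₂, h2, two w₂ h2 (e1.trans h5) h6⟩
    by_cases e2 : R w₁ w₂
    · exact Or.inl ⟨w₁, h1, two w₁ h1 h4 (e2.trans h6)⟩
    have e3 : ¬ R d w₂ := fun h => hno (h.trans h6)
    refine Or.inr ⟨w₁, w₂, h1, h2, ?_, ?_, ?_⟩
    · intro i j
      fin_cases i <;> fin_cases j <;>
        simp [hne w₁ h1, hne w₂ h2, h3, (hne w₁ h1).symm, (hne w₂ h2).symm, h3.symm]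
    · intro i
      fin_cases i
      · exact h4
      · exact h5
      · exact h6
    · intro i j
      fin_cases i <;> fin_cases j <;> intro hij
      · exact absurd rfl hij
      · exact e1
      · exact e3
      · exact fun h => e1 h.symm
      · exact absurd rfl hij
      · exact e2
      · exact fun h => e3 h.symm
      · exact fun h => e2 h.symm
      · exact absurd rfl hij

end Circles
end KnotProjection

/-! ### Few splices from circles, and circles from few splices. -/

namespace KnotProjection

section Unknotting

variable {D : Type*} {P : KnotProjection D}

theorem IsReduced.not_sameRegion (hP : P.IsReduced) (d : D) :
    ¬ P.SameRegion P.noSplice d (P.rot (P.rot d)) := by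
  intro h
  refine hP ⟨?_, d, rfl, h⟩
  rw [sameComponent_iff]
  intro S h1 h2 x hx y
  exact P.mem_of_closed h1 (fun z hz => by simpa [P.through_of_none (s := P.noSplice) rfl] using h2 z hz) hx y

theorem lt_three_of_pair {s : P.Splicing} (h : P.IsReducibleAfter s) {v w : P.DoublePoint}
    (hs : ∀ u, s u ≠ none → u = v ∨ u = w) : P.t < 3 := by
  refine (iInf₂_le s h).trans_lt (lt_of_le_of_lt (Set.encard_le_encard (t := {v, w}) hs) ?_)
  refine (Set.encard_insert_le _ _).trans_lt ?_
  rw [Set.encard_singleton]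
  exact (by decide : (1 + 1 : ℕ∞) < 3)

theorem lt_two_of_single {s : P.Splicing} (h : P.IsReducibleAfter s) {v : P.DoublePoint}
    (hs : ∀ u, s u ≠ none → u = v) : P.t < 2 := by
  refine (iInf₂_le s h).trans_lt (lt_of_le_of_lt (Set.encard_le_encard (t := {v}) hs) ?_)
  rw [Set.encard_singleton]
  exact (by decide : (1 : ℕ∞) < 2)

section

variable {k : ℕ} {c : Fin k → D} {s : P.Splicing} {S : Set D}

theorem rot_two_mem_of_supported (hsupp : ∀ x, s (P.vertex x) ≠ none → P.OnCircle c x)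
    (h2 : ∀ x ∈ S, P.through s x ∈ S) : ∀ x ∈ S, ¬ P.OnCircle c x → P.rot (P.rot x) ∈ S := by
  intro x hx hon
  rw [← P.through_of_none (s := s) (by by_contra h; exact hon (hsupp x h))]
  exact h2 x hx

theorem ArcJoins.mem_iff {d e : D} (h : P.ArcJoins c d e) (hd : P.OnCircle c d)
    (hsupp : ∀ x, s (P.vertex x) ≠ none → P.OnCircle c x)
    (h1 : ∀ x ∈ S, P.opp x ∈ S) (h2 : ∀ x ∈ S, P.through s x ∈ S) : d ∈ S ↔ e ∈ S :=
  ⟨h.mem h1 (rot_two_mem_of_supported hsupp h2),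
    (h.symm hd).mem h1 (rot_two_mem_of_supported hsupp h2)⟩

theorem sideDart_mem_iff_of_open {i : Fin k} (hi : P.Open s (c i))
    (h2 : ∀ x ∈ S, P.through s x ∈ S) (σ b b' : Bool) :
    P.sideDart c σ i b ∈ S ↔ P.sideDart c σ i b' ∈ S := by
  have key : ∀ b, P.sideDart c σ i b ∈ S → P.sideDart c σ i (!b) ∈ S := fun b h => by
    rw [← P.through_sideDart hi]; exact h2 _ h
  have h3 := key true
  have h4 := key false
  cases b <;> cases b' <;> simp_all <;> tauto

theorem sideDart_mem_iff_of_none {i : Fin k} (hi : s (P.vertex (c i)) = none)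
    (h2 : ∀ x ∈ S, P.through s x ∈ S) (σ b : Bool) :
    P.sideDart c σ i b ∈ S ↔ P.sideDart c (!σ) i (!b) ∈ S := by
  have key : ∀ σ b, P.sideDart c σ i b ∈ S → P.sideDart c (!σ) i (!b) ∈ S := fun σ b h => by
    rw [← rot_two_sideDart, ← P.through_of_none (s := s) (by simpa using hi)]; exact h2 _ h
  exact ⟨key σ b, fun h => by simpa using key _ _ h⟩

/-- A component of the spliced curve that avoids the circle would be a component of `P`, so it
suffices to connect the branches at the circle. -/
theorem sameComponent_of_sideDarts (hsupp : ∀ x, s (P.vertex x) ≠ none → P.OnCircle c x)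
    (h : ∀ S : Set D, (∀ x ∈ S, P.opp x ∈ S) → (∀ x ∈ S, P.through s x ∈ S) →
      ∃ p : Prop, ∀ σ i b, P.sideDart c σ i b ∈ S ↔ p) (d e : D) : P.SameComponent s d e := by
  revert d e
  rw [sameComponent_iff]
  intro S h1 h2 x hx y
  obtain ⟨p, hp⟩ := h S h1 h2
  refine mem_of_closed_off_circle h1 (rot_two_mem_of_supported hsupp h2) ?_ hx y
  intro x y hx hy hxS
  obtain ⟨σ, i, b, rfl⟩ := hx.exists_sideDart
  obtain ⟨σ', i', b', rfl⟩ := hy.exists_sideDart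
  rw [hp] at hxS ⊢
  exact hxS

end

theorem IsCircle.sameRegion_two {c : Fin 2 → D} (hc : P.IsCircle c) {s : P.Splicing}
    (h : P.Open s (c 1)) : P.SameRegion s (c 0) (P.rot (P.rot (c 0))) :=
  (hc.region_next 0).of_noSplice.trans
    ((SameRegion.channel h).symm.trans (hc.region_next 1).of_noSplice)

theorem IsCircle.sameRegion_three {c : Fin 3 → D} (hc : P.IsCircle c) {s : P.Splicing}
    (h1 : P.Open s (c 1)) (h2 : P.Open s (c 2)) :
    P.SameRegion s (c 0) (P.rot (P.rot (c 0))) :=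
  (hc.region_next 0).of_noSplice.trans ((SameRegion.channel h1).symm.trans
    ((hc.region_next 1).of_noSplice.trans
      ((SameRegion.channel h2).symm.trans (hc.region_next 2).of_noSplice)))

/-- Splicing along the circle at `c 1` turns each side into one strand with both ends at `c 0`, and
the crossing `c 0` joins the two strands. -/
theorem t_lt_two_of_interlaced (h : P.HasInterlacedTwoCircle) : P.t < 2 := by
  classical
  obtain ⟨c, hc, hl, hr⟩ := h
  have h01 : P.vertex (c 0) ≠ P.vertex (c 1) := fun h => by simpa using hc.vertex_injective h
  let s : P.Splicing := fun v => if v = P.vertex (c 1) then some (P.channelKind (c 1)) else none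
  have hs : ∀ v, s v ≠ none → v = P.vertex (c 1) := fun v hv => by
    by_contra h; exact hv (if_neg h)
  have hsupp : ∀ x, s (P.vertex x) ≠ none → P.OnCircle c x := fun x hx => ⟨1, hs _ hx⟩
  have h0 : s (P.vertex (c 0)) = none := if_neg h01
  have h1 : P.Open s (c 1) := P.open_of_eq_channelKind s (if_pos rfl)
  refine lt_two_of_single (s := s) ⟨?_, c 0, h0, hc.sameRegion_two h1⟩ hs
  refine sameComponent_of_sideDarts hsupp fun S hS1 hS2 =>
    ⟨P.sideDart c true 0 true ∈ S, fun σ i b => ?_⟩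
  have hl' : ∀ b, P.sideDart c false 0 b ∈ S ↔ P.sideDart c false 1 (!b) ∈ S := fun b =>
    (hl b).mem_iff (P.onCircle_sideDart false _ _) hsupp hS1 hS2
  have hr' : ∀ b, P.sideDart c true 0 b ∈ S ↔ P.sideDart c true 1 b ∈ S := fun b =>
    (hr b).mem_iff (P.onCircle_sideDart true _ _) hsupp hS1 hS2
  have e1 := sideDart_mem_iff_of_open h1 hS2 false true false
  have e2 := sideDart_mem_iff_of_open h1 hS2 true true false
  have e3 := sideDart_mem_iff_of_none h0 hS2 true true
  have l1 : _ ↔ P.sideDart c false 1 false ∈ S := hl' true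
  have l2 : _ ↔ P.sideDart c false 1 true ∈ S := hl' false
  have r1 := hr' true
  have r2 := hr' false
  have e4 := l2.symm.trans e3.symm
  match σ, i, b with
  | true, 0, true => exact Iff.rfl
  | true, 0, false => exact r2.trans (e2.symm.trans r1.symm)
  | true, 1, true => exact r1.symm
  | true, 1, false => exact e2.symm.trans r1.symm
  | false, 0, true => exact l1.trans (e1.symm.trans e4)
  | false, 0, false => exact e3.symm
  | false, 1, true => exact e4
  | false, 1, false => exact e1.symm.trans e4

theorem iff_true_of_iff_not {p : Bool → Prop} {x : Bool} (h : p x ↔ p !x) (b : Bool) :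
    p b ↔ p true := by
  cases x <;> cases b <;> simp_all

theorem t_lt_three_of_hasThreeCircle (h : P.HasThreeCircle) : P.t < 3 := by
  classical
  obtain ⟨c, hc, l, r, hl, hr, -⟩ := h
  have h01 : P.vertex (c 0) ≠ P.vertex (c 1) := fun h => by simpa using hc.vertex_injective h
  have h02 : P.vertex (c 0) ≠ P.vertex (c 2) := fun h => by simpa using hc.vertex_injective h
  have h21 : P.vertex (c 2) ≠ P.vertex (c 1) := fun h => by simpa using hc.vertex_injective h
  let s : P.Splicing := fun v => if v = P.vertex (c 1) then some (P.channelKind (c 1)) else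
    if v = P.vertex (c 2) then some (P.channelKind (c 2)) else none
  have hs : ∀ v, s v ≠ none → v = P.vertex (c 1) ∨ v = P.vertex (c 2) := fun v hv => by
    by_contra! h; exact hv (by simp [s, h])
  have hsupp : ∀ x, s (P.vertex x) ≠ none → P.OnCircle c x := fun x hx =>
    (hs _ hx).elim (fun h => ⟨1, h⟩) (fun h => ⟨2, h⟩)
  have h0 : s (P.vertex (c 0)) = none := by simp [s, h01, h02]
  have h1 : P.Open s (c 1) := P.open_of_eq_channelKind s (if_pos rfl)
  have h2 : P.Open s (c 2) := P.open_of_eq_channelKind s (by simp [s, h21])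
  refine lt_three_of_pair (s := s) ⟨?_, c 0, h0, hc.sameRegion_three h1 h2⟩ hs
  refine sameComponent_of_sideDarts hsupp fun S hS1 hS2 =>
    ⟨P.sideDart c true 0 true ∈ S, ?_⟩
  have e0 := sideDart_mem_iff_of_none h0 hS2 true true
  have e1 := sideDart_mem_iff_of_open h1 hS2
  have e2 := sideDart_mem_iff_of_open h2 hS2
  have side : ∀ σ, ∀ l : Fin 3 → Bool, (∀ i, P.ArcJoins c (P.sideDart c σ i (l i))
      (P.sideDart c σ (i + 1) (!(l (i + 1))))) →
      ∀ i b, P.sideDart c σ i b ∈ S ↔ P.sideDart c σ 0 true ∈ S := by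
    intro σ l hl
    have hl' := fun i => (hl i).mem_iff (P.onCircle_sideDart σ _ _) hsupp hS1 hS2
    have a0 : _ ↔ P.sideDart c σ 1 _ ∈ S := hl' 0
    have a1 : _ ↔ P.sideDart c σ 2 _ ∈ S := hl' 1
    have a2 : _ ↔ P.sideDart c σ 0 (!l 0) ∈ S := hl' 2
    have b0 := a0.trans ((e1 σ _ _).trans (a1.trans ((e2 σ _ _).trans a2)))
    have c0 := iff_true_of_iff_not (p := fun b => P.sideDart c σ 0 b ∈ S) b0
    intro i b
    match i with
    | 0 => exact c0 b
    | 1 => exact (e1 σ _ _).trans (a0.symm.trans (c0 _))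
    | 2 => exact (e2 σ _ _).trans (a2.trans (c0 _))
  intro σ i b
  cases σ
  · rw [side false l hl, e0, ← side false l hl 0 (!true)]
    rfl
  · exact side true r hr i b

/-- A single splice leaves only circles through two points, and a parallel one is excluded because
the splice would cut off an arc. -/
theorem hasInterlacedTwoCircle_of_t_lt_two (hP : P.IsReduced) (h : P.t < 2) :
    P.HasInterlacedTwoCircle := by
  simp only [t, iInf_lt_iff] at h
  obtain ⟨s, ⟨hcomp, d, hd, hreg⟩, hcard⟩ := h
  have hs : ∀ v w, s v ≠ none → s w ≠ none → v = w := by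
    intro v w hv hw
    by_contra hne
    have : ({v, w} : Set P.DoublePoint) ⊆ {v | s v ≠ none} := by
      rintro u (rfl | rfl) <;> assumption
    have := (Set.encard_le_encard this).trans_lt hcard
    rw [Set.encard_pair hne] at this
    exact lt_irrefl _ this
  rcases exists_isCircle (fun x y z hx hy _ hxy => absurd (hs _ _ hx hy) hxy) hd hreg
    (hP.not_sameRegion d) with ⟨w, hw, hc⟩ | ⟨w₁, w₂, h1, h2, hc⟩
  · rcases hc.interlaced_or_parallel with h | ⟨-, σ, h⟩
    · exact h
    · have hsupp : ∀ x, s (P.vertex x) ≠ none → P.OnCircle ![d, w] x := fun x hx =>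
        ⟨1, hs _ _ hx (Open.ne_none P hw)⟩
      exact (not_arcJoins_self hc.vertex_injective hcomp hsupp (i := 1) (j := 0) (by decide) hw
        σ false (h 1)).elim
  · have := hs _ _ (Open.ne_none P h1) (Open.ne_none P h2)
    have : (1 : Fin 3) = 2 := hc.vertex_injective this
    exact absurd this (by decide)

theorem parallel_or_three_of_t_lt_three (hP : P.IsReduced) (hno : ¬ P.HasInterlacedTwoCircle)
    (h : P.t < 3) : P.HasParallelTwoCircle ∨ P.HasThreeCircle := by
  simp only [t, iInf_lt_iff] at h
  obtain ⟨s, ⟨hcomp, d, hd, hreg⟩, hcard⟩ := h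
  have hs : ∀ u v w, s u ≠ none → s v ≠ none → s w ≠ none → u ≠ v → w = u ∨ w = v := by
    intro u v w hu hv hw huv
    by_contra! hne
    have : ({w, u, v} : Set P.DoublePoint) ⊆ {v | s v ≠ none} := by
      rintro u (rfl | rfl | rfl) <;> assumption
    have := (Set.encard_le_encard this).trans_lt hcard
    rw [Set.encard_insert_of_notMem (by simp [hne]), Set.encard_pair huv] at this
    exact absurd this (by decide)
  rcases exists_isCircle (fun x y z => hs _ _ _) hd hreg
    (hP.not_sameRegion d) with ⟨w, hw, hc⟩ | ⟨w₁, w₂, h1, h2, hc⟩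
  · exact Or.inl (hc.interlaced_or_parallel.resolve_left hno).1
  · have h12 : P.vertex w₁ ≠ P.vertex w₂ := fun h => by
      have : (1 : Fin 3) = 2 := hc.vertex_injective h
      exact absurd this (by decide)
    refine Or.inr (hc.hasThreeCircle hcomp (fun x hx => ?_) fun i hi => ?_)
    · exact (hs _ _ _ (Open.ne_none P h1) (Open.ne_none P h2) hx h12).elim
        (fun h => ⟨1, h⟩) (fun h => ⟨2, h⟩)
    · match i with
      | 0 => exact absurd rfl hi
      | 1 => exact h1
      | 2 => exact h2

end Unknotting
end KnotProjection

/-! ### Parallel circles: a second splice reconnects the curve. -/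

namespace KnotProjection

section Parallel

variable {D : Type*} {P : KnotProjection D}

/-- If a splice along `w` cuts off the component `X`, then a further splice at a double point `x`
where `X` meets the rest of the curve yields one component again. -/
theorem sameComponent_of_merging {X : Set D} (hX : ∀ x, P.opp x ∈ X ↔ x ∈ X) {w x : D}
    (hw0 : w ∉ X) (hw1 : P.rot w ∈ X) (hw2 : P.rot (P.rot w) ∈ X)
    (hw3 : P.rot (P.rot (P.rot w)) ∉ X)
    (hXrot : ∀ y, P.vertex y ≠ P.vertex w → (P.rot (P.rot y) ∈ X ↔ y ∈ X))
    (hxw : P.vertex x ≠ P.vertex w) (hx : x ∈ X) (hx1 : P.rot x ∉ X) {s : P.Splicing}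
    (hsw : P.Open s w) (hsx : s (P.vertex x) ≠ none)
    (hs : ∀ y, s (P.vertex y) ≠ none → P.vertex y = P.vertex w ∨ P.vertex y = P.vertex x) :
    ∀ d e, P.SameComponent s d e := by
  classical
  have := P.finite
  have hx2 : P.rot (P.rot x) ∈ X := (hXrot x hxw).2 hx
  have hx3 : P.rot (P.rot (P.rot x)) ∉ X := by
    rwa [hXrot (P.rot x) (by simpa using hxw)]
  have ht0 : P.through s w = P.rot (P.rot (P.rot w)) := by
    rw [P.through_of_open hsw, rot_inv_apply]
  have ht1 : P.through s (P.rot w) = P.rot (P.rot w) :=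
    P.through_of_open_rot ((P.open_rot_two s w).2 hsw)
  have ht2 : P.through s (P.rot (P.rot w)) = P.rot w := by rw [← ht1, through_through]
  have ht3 : P.through s (P.rot (P.rot (P.rot w))) = w := by rw [← ht0, through_through]
  -- `s'` is the splice along `w` only
  let s' : P.Splicing := fun v => if v = P.vertex w then s v else none
  have hs'w : ∀ y, P.vertex y = P.vertex w → P.through s' y = P.through s y := by
    intro y hy
    simp [through, Open, s', hy]
  have hs'o : ∀ y, P.vertex y ≠ P.vertex w → P.through s' y = P.rot (P.rot y) := by
    intro y hy
    exact P.through_of_none (by simp [s', hy])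
  have hso : ∀ y, P.vertex y ≠ P.vertex w → P.vertex y ≠ P.vertex x →
      P.through s y = P.rot (P.rot y) := by
    intro y hy hy'
    refine P.through_of_none ?_
    by_contra h
    exact (hs y h).elim hy hy'
  have hXs' : ∀ y ∈ X, P.through s' y ∈ X := by
    intro y hy
    by_cases hyw : P.vertex y = P.vertex w
    · rw [hs'w y hyw]
      rcases P.eq_of_vertex_eq hyw with rfl | rfl | rfl | rfl
      · exact absurd hy hw0
      · rwa [ht1]
      · rwa [ht2]
      · exact absurd hy hw3
    · rw [hs'o y hyw]
      exact (hXrot y hyw).2 hy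
  have hXs'c : ∀ y ∈ Xᶜ, P.through s' y ∈ Xᶜ := fun y hy h =>
    hy (by simpa [through_through] using hXs' _ h)
  -- at `x` the set `S` is closed under going straight ahead
  have cut : ∀ S : Set D, (∀ y ∈ S, P.opp y ∈ S) → (∀ y ∈ S, P.through s y ∈ S) →
      ∀ Y : Set D, (∀ y ∈ Y, P.opp y ∈ Y) → (∀ y ∈ Y, P.through s' y ∈ Y) →
      ∀ y, P.vertex y = P.vertex x → y ∈ Y → P.rot y ∉ Y → P.rot (P.rot (P.rot y)) ∉ Y →
        y ∈ S → P.rot (P.rot y) ∈ S := by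
    intro S hS1 hS2 Y hY1 hY2 y hyx hyY hy1 hy3 hyS
    by_contra hcon
    have hyw : P.vertex y ≠ P.vertex w := hyx ▸ hxw
    -- Cutting the closed strand in `Y` open at `x` leaves both cut ends in the same component.
    -- Formally, `S ∩ Y` is closed under `opp`, and under `through s'` except possibly at `y`.
    have := apply_mem_of_involutions (S := S ∩ Y) P.opp_opp P.opp_ne (P.through_through s')
      (P.through_ne s') (a := y) ⟨hyS, hyY⟩ (fun z hz => ⟨hS1 z hz.1, hY1 z hz.2⟩)
      (fun z hz hzy => ⟨?_, hY2 z hz.2⟩)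
    · rw [hs'o y hyw] at this
      exact hcon this.1
    · by_cases hzx : P.vertex z = P.vertex x
      · rcases P.eq_of_vertex_eq (hzx.trans hyx.symm) with rfl | rfl | rfl | rfl
        · exact absurd rfl hzy
        · exact absurd hz.2 hy1
        · exact absurd hz.1 hcon
        · exact absurd hz.2 hy3
      · by_cases hzw : P.vertex z = P.vertex w
        · rw [hs'w z hzw]; exact hS2 z hz.1
        · rw [hs'o z hzw, ← hso z hzw hzx]; exact hS2 z hz.1
  have ahead_mem : ∀ S : Set D, (∀ y ∈ S, P.opp y ∈ S) → (∀ y ∈ S, P.through s y ∈ S) →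
      ∀ y ∈ S, P.vertex y ≠ P.vertex w → P.rot (P.rot y) ∈ S := by
    intro S hS1 hS2 y hy hyw
    by_cases hyx : P.vertex y = P.vertex x
    · have c1 := cut S hS1 hS2 X (fun z hz => (hX z).2 hz) hXs'
      have c2 := cut S hS1 hS2 Xᶜ (fun z hz h => hz ((hX z).1 h)) hXs'c
      rcases P.eq_of_vertex_eq hyx with rfl | rfl | rfl | rfl
      · exact c1 _ hyx hx hx1 hx3 hy
      · exact c2 _ hyx hx1 (by simpa using hx2) (by simpa [P.rot_four] using hx) hy
      · exact c1 _ hyx hx2 hx3 (by simpa [P.rot_four] using hx1) hy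
      · refine c2 _ hyx hx3 ?_ ?_ hy
        · simpa [P.rot_four] using hx
        · simpa [P.rot_four] using hx2
    · rw [← hso y hyw hyx]; exact hS2 y hy
  have rot_mem : ∀ S : Set D, (∀ y ∈ S, P.opp y ∈ S) → (∀ y ∈ S, P.through s y ∈ S) →
      x ∈ S → P.rot x ∈ S := by
    intro S hS1 hS2 hxS
    have h := hS2 x hxS
    rcases P.open_or_open_rot s hsx with ho | ho
    · rw [P.through_of_open ho, rot_inv_apply] at h
      simpa [P.rot_four] using ahead_mem S hS1 hS2 _ h (by simpa using hxw)
    · rwa [P.through_of_open_rot ho] at h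
  -- An invariant `S` separating the two strands at `w` makes `X \ S` (if `x ∉ S`) or `S \ X` (if `x
  -- ∈ S`) a nonempty union of components of `P` that misses `w`.
  have link : ∀ S : Set D, (∀ y ∈ S, P.opp y ∈ S) → (∀ y ∈ S, P.through s y ∈ S) →
      P.rot w ∈ S → w ∈ S := by
    intro S hS1 hS2 h1
    by_contra h0
    have h2 : P.rot (P.rot w) ∈ S := ht1 ▸ hS2 _ h1
    have h3 : P.rot (P.rot (P.rot w)) ∉ S := fun h => h0 (ht3 ▸ hS2 _ h)
    have hSr : ∀ y, P.vertex y ≠ P.vertex w → (P.rot (P.rot y) ∈ S ↔ y ∈ S) := fun y hy =>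
      ⟨fun h => by simpa [P.rot_four] using ahead_mem S hS1 hS2 _ h (by simpa using hy),
        fun h => ahead_mem S hS1 hS2 y h hy⟩
    have hSo : ∀ y, P.opp y ∈ S ↔ y ∈ S := fun y =>
      ⟨fun h => by simpa [P.opp_opp] using hS1 _ h, hS1 y⟩
    have hxS : x ∈ S := by
      by_contra hxS
      refine hw0 (P.mem_of_closed (S := X \ S) (fun y hy => ?_) (fun y hy => ?_) ⟨hx, hxS⟩ w).1
      · rwa [Set.mem_sdiff, hX, hSo]
      · by_cases hyw : P.vertex y = P.vertex w
        · rcases P.eq_of_vertex_eq hyw with rfl | rfl | rfl | rfl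
          · exact absurd hy.1 hw0
          · exact absurd h1 hy.2
          · exact absurd h2 hy.2
          · exact absurd hy.1 hw3
        · rwa [Set.mem_sdiff, hXrot y hyw, hSr y hyw]
    refine h0 (P.mem_of_closed (S := S \ X) (fun y hy => ?_) (fun y hy => ?_)
      ⟨rot_mem S hS1 hS2 hxS, hx1⟩ w).1
    · rwa [Set.mem_sdiff, hX, hSo]
    · by_cases hyw : P.vertex y = P.vertex w
      · rcases P.eq_of_vertex_eq hyw with rfl | rfl | rfl | rfl
        · exact absurd hy.1 h0
        · exact absurd hw1 hy.2
        · exact absurd hw2 hy.2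
        · exact absurd hy.1 h3
      · rwa [Set.mem_sdiff, hXrot y hyw, hSr y hyw]
  rw [sameComponent_iff]
  intro S hS1 hS2 y hy z
  -- The converse is `link` for the complement. Hence `S` is also closed under going straight ahead
  -- at `w`, and is trivial because `P` is connected.
  have hlink : P.rot w ∈ S ↔ w ∈ S := by
    refine ⟨link S hS1 hS2, fun h => ?_⟩
    by_contra h'
    exact link Sᶜ (fun y hy h => hy (by simpa [P.opp_opp] using hS1 _ h))
      (fun y hy h => hy (by simpa [through_through] using hS2 _ h)) h' h
  refine P.mem_of_closed hS1 (fun y hy => ?_) hy z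
  by_cases hyw : P.vertex y = P.vertex w
  · have e0 := hS2 w
    have e1 := hS2 (P.rot w)
    have e2 := hS2 (P.rot (P.rot w))
    have e3 := hS2 (P.rot (P.rot (P.rot w)))
    rw [ht0] at e0
    rw [ht1] at e1
    rw [ht2] at e2
    rw [ht3] at e3
    rcases P.eq_of_vertex_eq hyw with rfl | rfl | rfl | rfl
    · exact e1 (hlink.2 hy)
    · exact e0 (hlink.1 hy)
    · rw [P.rot_four]; exact hlink.1 (e2 hy)
    · rw [P.rot_four]; exact hlink.2 (e3 hy)
  · exact ahead_mem S hS1 hS2 y hy hyw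

theorem t_lt_three_of_hasParallelTwoCircle (hP : P.IsReduced) (h : P.HasParallelTwoCircle) :
    P.t < 3 := by
  classical
  obtain ⟨c, hc, hl, -⟩ := h
  have h01 : P.vertex (c 0) ≠ P.vertex (c 1) := fun h => by simpa using hc.vertex_injective h
  obtain ⟨X, hX1, hX2, hX3⟩ := (hl 1).exists_set (P.onCircle_sideDart false 1 false)
  replace hX3 : ∀ x, P.OnCircle c x → (x ∈ X ↔ x = P.rot (c 1) ∨ x = P.rot (P.rot (c 1))) := hX3
  have hon : ∀ y, P.vertex y = P.vertex (c 1) → P.OnCircle c y := fun y hy => ⟨1, hy⟩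
  have hoff : ∀ y, P.vertex y = P.vertex (c 0) → y ∉ X := fun y hy h => by
    rcases (hX3 y ⟨0, hy⟩).1 h with rfl | rfl <;> simp at hy <;> exact h01 hy.symm
  have hw0 : c 1 ∉ X := by
    rw [hX3 _ (hon _ rfl), not_or]
    exact ⟨(P.rot_ne _).symm, (P.rot_two_ne _).symm⟩
  have hw1 : P.rot (c 1) ∈ X := (hX3 _ (hon _ (by simp))).2 (Or.inl rfl)
  have hw2 : P.rot (P.rot (c 1)) ∈ X := (hX3 _ (hon _ (by simp))).2 (Or.inr rfl)
  have hw3 : P.rot (P.rot (P.rot (c 1))) ∉ X := by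
    rw [hX3 _ (hon _ (by simp)), not_or]
    exact ⟨P.rot_two_ne _, P.rot_ne _⟩
  -- If the loop `X` at `c 1` crossed no other part of the curve, `c 1` would be nugatory in `P`.
  obtain ⟨x, hxon, hx, hx1⟩ : ∃ x, ¬ P.OnCircle c x ∧ x ∈ X ∧ P.rot x ∉ X := by
    by_contra! hcon
    refine hP.not_sameRegion (c 1) (sameRegion_of_separated hX1 hw0 hw1 fun x hx0 hx2 => ?_)
    by_cases h1 : P.vertex x = P.vertex (c 1)
    · rcases P.eq_of_vertex_eq h1 with rfl | rfl | rfl | rfl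
      · exact absurd rfl hx0
      · exact iff_of_true hw2 hw1
      · exact absurd rfl hx2
      · rw [P.rot_four]; exact iff_of_false hw0 hw3
    by_cases h0 : P.vertex x = P.vertex (c 0)
    · exact iff_of_false (hoff _ (by simpa using h0)) (hoff _ h0)
    have hxon : ¬ P.OnCircle c x := by
      rintro ⟨i, hi⟩
      match i with
      | 0 => exact h0 hi
      | 1 => exact h1 hi
    refine ⟨fun h => ?_, hcon x hxon⟩
    simpa [P.rot_four] using hcon _ (by simpa using hxon) (hcon _ (by simpa using hxon)
      (hcon _ (by simpa using hxon) h))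
  have hxw : P.vertex x ≠ P.vertex (c 1) := fun h => hxon ⟨1, h⟩
  have hx0 : P.vertex x ≠ P.vertex (c 0) := fun h => hxon ⟨0, h⟩
  -- Either kind of splice at `x` merges the two components, so `seifert` is an arbitrary choice;
  -- the channel at `c 1` keeps `c 0` nugatory.
  let s : P.Splicing := fun v => if v = P.vertex (c 1) then some (P.channelKind (c 1)) else
    if v = P.vertex x then some .seifert else none
  have hs : ∀ v, s v ≠ none → v = P.vertex (c 1) ∨ v = P.vertex x := fun v hv => by
    by_contra! h; exact hv (by simp [s, h])
  have hopen : P.Open s (c 1) := P.open_of_eq_channelKind s (if_pos rfl)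
  refine lt_three_of_pair (s := s) ⟨?_, c 0, ?_, hc.sameRegion_two hopen⟩ hs
  · refine sameComponent_of_merging hX1 hw0 hw1 hw2 hw3 (fun y hy => ?_) hxw hx hx1 hopen
      (by simp [s, hxw]) (fun y => hs _)
    by_cases h0 : P.vertex y = P.vertex (c 0)
    · exact iff_of_false (hoff _ (by simpa using h0)) (hoff _ h0)
    · refine hX2 y ?_
      rintro ⟨i, hi⟩
      match i with
      | 0 => exact h0 hi
      | 1 => exact hy hi
  · simp [s, h01, hx0.symm]

end Parallel
end KnotProjection

theorem mainTheorem2 {D : Type*} (P : KnotProjection D) (hP : P.IsReduced) :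
    (¬ P.HasInterlacedTwoCircle ∧ (P.HasParallelTwoCircle ∨ P.HasThreeCircle)) ↔ P.t = 2 := by
  constructor
  · rintro ⟨h1, h2⟩
    have hle : P.t < 2 + 1 := by
      rw [show (2 + 1 : ℕ∞) = 3 from rfl]
      exact h2.elim (KnotProjection.t_lt_three_of_hasParallelTwoCircle hP)
        KnotProjection.t_lt_three_of_hasThreeCircle
    exact le_antisymm (Order.le_of_lt_add_one hle)
      (not_lt.1 fun h => h1 (KnotProjection.hasInterlacedTwoCircle_of_t_lt_two hP h))
  · intro h
    have h1 : ¬ P.HasInterlacedTwoCircle := fun h' =>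
      (KnotProjection.t_lt_two_of_interlaced h').ne h
    exact ⟨h1, KnotProjection.parallel_or_three_of_t_lt_three hP h1
      (by rw [h]; decide)⟩
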